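/- Let $D<0$ be the discriminant of an imaginary quadratic order $\mathcal O$ (so $D\equiv 0,1 \pmod 4$), let $h(D)$ be its class number, and put $\sqrt D=i\sqrt{|D|}$. Let $p_1\neq p_2$ be odd primes, $N=p_1p_2$, $s=24/\gcd(24,(p_1-1)(p_2-1))$, and let $$\mathfrak w(z)=\frac{\eta(z/p_1)\,\eta(z/p_2)}{\eta(z)\,\eta(z/N)},$$ where $\eta$ is the Dedekind eta function. An $N$-system for $D$ is a set $\mathfrak N$ of $h(D)$ primitive positive definite integral binary quadratic forms $[A_i,B_i,C_i]=A_iX^2+B_iXY+C_iY^2$ of discriminant $D$ such that $\gcd(A_i,N)=1$, $N\mid C_i$ and $B_i\equiv B_j\pmod{2N}$ for all $i,j$, and such that the ideals $\mathbb Z A_i+\mathbb Z\frac{-B_i+\sqrt D}{2}$ represent every class of invertible ideals of $\mathcal O$ exactly once. For an integer $B$ with $B^2\equiv D\pmod{4N}$ let $\mathfrak N$ be any $N$-system for $D$ that contains $[1,B,(B^2-D)/4]$ and put $$H_{B,N}(X)=\prod_{[A_i,B_i,C_i]\in\mathfrak N}\left(X-\mathfrak w\!\left(\frac{-B_i+\sqrt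 D}{2A_i}\right)^{s}\right)\in\mathbb C[X].$$ Suppose that $\left(\frac{D}{p_1}\right)=\left(\frac{D}{p_2}\right)=1$, and let $B,B'$ be integers with $B^2\equiv B'^2\equiv D\pmod{4N}$, $B'\equiv B\pmod{p_1}$ and $B'\equiv -B\pmod{p_2}$. Then, for every choice of the $N$-systems defining $H_{B,N}$ and $H_{B',N}$, one has $H_{B,N}(0)\neq 0$ and, in $\mathbb C(X)$, $$H_{B',N}(X)=\frac{X^{h(D)}}{H_{B,N}(0)}\;H_{B,N}\!\left(\frac{\left(\frac{p_1}{p_2}\right)^{s}}{X}\right).$$ -/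

import Mathlib

open scoped nonZeroDivisors

namespace EtaClassPoly

/-- The square root `√D = i √|D|` in the upper half-plane of a negative integer `D`. -/
noncomputable def sqrtDisc (D : ℤ) : ℂ := (Real.sqrt (-(D : ℝ)) : ℂ) * Complex.I

/-- The imaginary quadratic order of discriminant `D`, realised in `ℂ` as `ℤ[(D + √D) / 2]`
(for `D < 0` with `D ≡ 0, 1 mod 4`; if `D = f² d_K`, this is the order of conductor `f` in
`K = ℚ(√D)`). -/
noncomputable def quadOrder (D : ℤ) : Subalgebra ℤ ℂ :=
  Algebra.adjoin ℤ {((D : ℂ) + sqrtDisc D) / 2}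

/-- The class number `h(D)`: the order of the group of proper (that is, invertible) fractional
ideals modulo principal ones of the order of discriminant `D`. -/
noncomputable def classNumber (D : ℤ) : ℕ := Nat.card (ClassGroup (quadOrder D))

/-- The integral binary quadratic form `[a, b, c] = a X² + b X Y + c Y²`. -/
structure BinForm where
  a : ℤ
  b : ℤ
  c : ℤ

/-- The discriminant `b² - 4ac`. -/
def BinForm.disc (q : BinForm) : ℤ := q.b ^ 2 - 4 * q.a * q.c

/-- A form is primitive if its three coefficients have no common prime factor. -/
def BinForm.IsPrimitive (q : BinForm) : Prop := Int.gcd q.a (Int.gcd q.b q.c) = 1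

/-- The ideal `𝔞_q = [a, (-b + √D) / 2]` of the order of discriminant `D` attached to a form `q` of
discriminant `D`. It is written as the ideal generated by `a` and `(-b + √D) / 2`, which is the
lattice `ℤ a + ℤ (-b + √D) / 2`, because this lattice is an ideal when `D = b² - 4ac`. -/
noncomputable def BinForm.ideal (D : ℤ) (q : BinForm) : Ideal (quadOrder D) :=
  Ideal.span {x | (x : ℂ) = (q.a : ℂ) ∨ (x : ℂ) = (-(q.b : ℂ) + sqrtDisc D) / 2}

/-- The basis quotient `α_q = (-b + √D) / (2a)`. -/
noncomputable def BinForm.root (D : ℤ) (q : BinForm) : ℂ :=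
  (-(q.b : ℂ) + sqrtDisc D) / (2 * (q.a : ℂ))

/-- The ideal `I` of the domain `R` is invertible (as a fractional ideal) and its class in the ideal
class group of `R` is `κ`. -/
def HasClass {R : Type*} [CommRing R] [IsDomain R] (I : Ideal R) (κ : ClassGroup R) : Prop :=
  ∃ J : (FractionalIdeal R⁰ (FractionRing R))ˣ,
    (J : FractionalIdeal R⁰ (FractionRing R)) = (I : FractionalIdeal R⁰ (FractionRing R)) ∧
      ClassGroup.mk (FractionRing R) J = κ

/-- `S` is an `N`-system for `D`: a set of `h(D)` primitive (positive definite) forms `[a, b, c]` of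
discriminant `D` with `gcd(a, N) = 1`, with all `b` congruent modulo `2N`, with `N ∣ c`, and such
that the ideals `[a, (-b + √D) / 2]` form a system of representatives of the ideal class group of
the order of discriminant `D`. -/
structure IsNSystem (D : ℤ) (N : ℕ) (S : Finset BinForm) : Prop where
  card_eq : S.card = classNumber D
  primitive : ∀ q ∈ S, q.IsPrimitive
  disc_eq : ∀ q ∈ S, q.disc = D
  pos : ∀ q ∈ S, 0 < q.a
  coprime : ∀ q ∈ S, Int.gcd q.a N = 1
  congr : ∀ q ∈ S, ∀ r ∈ S, q.b ≡ r.b [ZMOD 2 * N]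
  dvd : ∀ q ∈ S, (N : ℤ) ∣ q.c
  invertible : ∀ q ∈ S, ∃ κ : ClassGroup (quadOrder D), HasClass (q.ideal D) κ
  representatives : ∀ κ : ClassGroup (quadOrder D), ∃! q, q ∈ S ∧ HasClass (q.ideal D) κ

/-- The double eta quotient `𝔴_{p₁,p₂}(z) = η(z/p₁) η(z/p₂) / (η(z) η(z/(p₁p₂)))`. -/
noncomputable def doubleEta (p₁ p₂ : ℕ) (z : ℂ) : ℂ :=
  ModularForm.eta (z / p₁) * ModularForm.eta (z / p₂) /
    (ModularForm.eta z * ModularForm.eta (z / (p₁ * p₂)))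

/-- The exponent `s = 24 / gcd(24, (p₁ - 1)(p₂ - 1))`. -/
def etaExponent (p₁ p₂ : ℕ) : ℕ := 24 / Nat.gcd 24 ((p₁ - 1) * (p₂ - 1))

/-- The class polynomial `H_S(X) = ∏_{q ∈ S} (X - 𝔴_{p₁,p₂}(α_q)^s)` of an `N`-system `S` for `D`,
where `N = p₁p₂`. -/
noncomputable def classPoly (D : ℤ) (p₁ p₂ : ℕ) (S : Finset BinForm) : Polynomial ℂ :=
  ∏ q ∈ S, (Polynomial.X - Polynomial.C (doubleEta p₁ p₂ (q.root D) ^ etaExponent p₁ p₂))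

end EtaClassPoly

/-! The Atkin–Lehner involution `W` at `p₂` swaps, up to `SL₂(ℤ)`, the arguments `z` and `z/p₂`, and
likewise `z/p₁` and `z/(p₁p₂)`. It therefore inverts the double eta quotient up to a constant, and
the multiplier of `η` shows that `𝔴(Wz)^s 𝔴(z)^s = (p₁/p₂)^s` (`doubleEta_atkinLehner`). The
multiplier is needed only for odd lower left entry (`etaTransform`); the remaining matrices are
reduced to that case by invariance of `𝔴^s` under `z ↦ z/(z+1)`.

On forms, dividing the root `α` of `[a,b,c]` by `p₂` gives `[a p₂, b, c/p₂]`, which is primitive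
because `(D/p₂) = 1` forces `p₂ ∤ b`. Its class contains a unique form of the second system, whose
root is `M(α/p₂)` for some `M` in `SL₂(ℤ)`. The congruences on `B'` force `M·diag(1,p₂)` to be an
Atkin–Lehner matrix (`atkinLehnerRelated_of_moebius`). This gives a map between the two systems. It
is injective, since roots with the same image are `SL₂(ℤ)`-equivalent and so lie in one class; equal
cardinalities make it bijective. Values at corresponding roots multiply to `(p₁/p₂)^s`, and the
identity follows factor by factor (`classPoly_eq_of_reciprocal`). -/

namespace EtaClassPoly

open Complex hiding eta
open ModularForm NumberTheorySymbols

/-! ### The multiplier of `η` for odd lower left entry. -/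

/-- The primitive 24th root of unity `exp (π i / 12)`. -/
noncomputable def zeta : ℂ := cexp (Real.pi * I / 12)

lemma zeta_ne_zero : zeta ≠ 0 := exp_ne_zero _

lemma zeta_pow_twelve : zeta ^ 12 = -1 := by
  rw [zeta, ← exp_nat_mul, ← exp_pi_mul_I]; congr 1; push_cast; ring

lemma zeta_pow_twentyFour : zeta ^ 24 = 1 := by
  rw [show 24 = 12 * 2 from rfl, pow_mul, zeta_pow_twelve]; norm_num

lemma zeta_zpow_eq_one {n : ℤ} (h : (24 : ℤ) ∣ n) : zeta ^ n = 1 := by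
  obtain ⟨k, rfl⟩ := h
  rw [zpow_mul, show zeta ^ (24 : ℤ) = 1 from mod_cast zeta_pow_twentyFour, one_zpow]

lemma zeta_zpow_twelve_mul (n : ℤ) : zeta ^ (12 * n) = (-1) ^ n := by
  rw [zpow_mul, show zeta ^ (12 : ℤ) = -1 from mod_cast zeta_pow_twelve]

/-- Accounts for the constant `+ 3` in `etaExp`: it cancels the factor `(sqrt I)⁻¹` that
`EtaTransform` keeps explicit. -/
lemma sqrt_I_eq_zeta : sqrt I = zeta ^ 3 := by
  rw [sqrt_eq_exp I_ne_zero, log_I, zeta, ← exp_nat_mul]; congr 1; push_cast; ring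

lemma sqrt_sq' (z : ℂ) : sqrt z * sqrt z = z := by
  have := Complex.cpow_nat_inv_pow z (n := 2) (by norm_num)
  rw [sq] at this
  simpa [Complex.sqrt] using this

lemma sqrt_quadrant {z : ℂ} (hz : 0 < z.im) : 0 < (sqrt z).re ∧ 0 < (sqrt z).im := by
  have h0 : z ≠ 0 := by rintro rfl; simp at hz
  have ha := Complex.arg_lt_pi_iff.2 (Or.inr hz.ne')
  have hb : 0 < arg z := (Complex.arg_nonneg_iff.2 hz.le).lt_of_ne
    fun h => hz.ne' (Complex.arg_eq_zero_iff.1 h.symm).2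
  rw [sqrt_eq_exp h0, exp_re, exp_im]
  have h1 : (log z / 2).im = arg z / 2 := by simp [log_im]
  rw [h1]
  exact ⟨mul_pos (Real.exp_pos _) (Real.cos_pos_of_mem_Ioo ⟨by linarith [Real.pi_pos], by linarith⟩),
    mul_pos (Real.exp_pos _) (Real.sin_pos_of_pos_of_lt_pi (by linarith) (by linarith))⟩

/-- The two sides agree up to sign. All three roots lie in the open first quadrant, so the left side
has positive imaginary part, which excludes the minus sign. -/
lemma sqrt_mul_of_im_pos {u v : ℂ} (hu : 0 < u.im) (hv : 0 < v.im) (huv : 0 < (u * v).im) :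
    sqrt u * sqrt v = sqrt (u * v) := by
  obtain ⟨h1, h2⟩ := sqrt_quadrant hu
  obtain ⟨h3, h4⟩ := sqrt_quadrant hv
  obtain ⟨h5, h6⟩ := sqrt_quadrant huv
  have h : (sqrt u * sqrt v) * (sqrt u * sqrt v) = sqrt (u * v) * sqrt (u * v) := by
    rw [sqrt_sq', mul_mul_mul_comm, sqrt_sq', sqrt_sq']
  rcases mul_self_eq_mul_self_iff.1 h with h | h
  · exact h
  · have := congrArg im h
    rw [mul_im, neg_im] at this
    nlinarith [mul_pos h1 h4, mul_pos h2 h3]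

lemma eta_add_int (z : ℂ) (n : ℤ) : eta (z + n) = zeta ^ n * eta z := by
  have h1 : ∀ k, eta_q k (z + n) = eta_q k z := by
    intro k
    have : Function.Periodic.qParam 1 (z + n) = Function.Periodic.qParam 1 z := by
      rw [Function.Periodic.qParam, Function.Periodic.qParam, exp_eq_exp_iff_exists_int]
      exact ⟨n, by push_cast; ring⟩
    simp only [eta_q, this]
  have h2 : Function.Periodic.qParam 24 (z + n) = zeta ^ n * Function.Periodic.qParam 24 z := by
    rw [Function.Periodic.qParam, Function.Periodic.qParam, zeta, ← exp_int_mul, ← exp_add]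
    congr 1; push_cast; ring
  simp only [eta, h1, h2, mul_assoc]

lemma eta_neg_one_div {z : ℂ} (hz : 0 < z.im) :
    eta (-1 / z) = (sqrt I)⁻¹ * (sqrt z * eta z) := by
  simpa using eta_comp_eq_csqrt_I_inv hz

lemma im_moebius {a b c d : ℤ} (h : a * d - b * c = 1) (z : ℂ) :
    ((a * z + b) / (c * z + d) : ℂ).im = z.im / normSq (c * z + d) := by
  have h' : (a : ℝ) * d - b * c = 1 := mod_cast h
  rw [div_im]
  simp only [add_im, mul_im, intCast_re, intCast_im, add_re, mul_re, zero_mul, sub_zero, add_zero]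
  rw [← sub_div]; congr 1; linear_combination z.im * h'

lemma denom_ne_zero {a b c d : ℤ} (h : a * d - b * c = 1) {z : ℂ} (hz : 0 < z.im) :
    (c * z + d : ℂ) ≠ 0 := by
  intro h0
  have hi := congrArg im h0
  have hr := congrArg re h0
  simp only [add_im, mul_im, intCast_re, intCast_im, add_re, mul_re, zero_mul, sub_zero, add_zero,
    zero_im, zero_re, mul_eq_zero] at hi hr
  have hc : c = 0 := by
    rcases hi with h | h
    · exact mod_cast h
    · exact absurd h hz.ne'
  subst hc
  have hd : d = 0 := by simpa using hr
  subst hd; simp at h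

lemma moebius_im_pos {a b c d : ℤ} (h : a * d - b * c = 1) {z : ℂ} (hz : 0 < z.im) :
    0 < ((a * z + b) / (c * z + d) : ℂ).im := by
  rw [im_moebius h]
  exact div_pos hz (normSq_pos.2 (denom_ne_zero h hz))

/-- The exponent of `zeta` in the multiplier of `η` at a matrix with odd positive lower left
entry. -/
def etaExp (a b c d : ℤ) : ℤ := (a + d) * c - b * d * (c ^ 2 - 1) - 3 * c + 3

/-- The transformation law of `η` under `z ↦ (a z + b) / (c z + d)`. -/
def EtaTransform (a b : ℤ) (c : ℕ) (d : ℤ) : Prop :=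
  ∀ z : ℂ, 0 < z.im → eta ((a * z + b) / (c * z + d)) =
    J(d | c) * zeta ^ etaExp a b c d * (sqrt I)⁻¹ * sqrt (c * z + d) * eta z

lemma dvd_cube_sub_of_odd {c : ℤ} (hc : Odd c) : (24 : ℤ) ∣ c * (c ^ 2 - 1) := by
  obtain ⟨k, rfl⟩ := hc
  have h3 : (3 : ℤ) ∣ k * (k + 1) * (2 * k + 1) := by
    have : k % 3 = 0 ∨ k % 3 = 1 ∨ k % 3 = 2 := by omega
    apply Int.dvd_of_emod_eq_zero
    rcases this with h | h | h <;> simp [Int.mul_emod, Int.add_emod, h]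
  have h2 : (2 : ℤ) ∣ k * (k + 1) := (Int.even_mul_succ_self k).two_dvd
  have h6 : (6 : ℤ) ∣ k * (k + 1) * (2 * k + 1) := by
    have := h2.mul_right (2 * k + 1)
    omega
  obtain ⟨m, hm⟩ := h6
  exact ⟨m, by linear_combination 4 * hm⟩

/-- Substituting `z - k` for `z` lets `d` be changed modulo `c`. The exponents then match only
modulo 24, because `24 ∣ c (c² - 1)` for odd `c`. -/
lemma EtaTransform.translate {a b d : ℤ} {c : ℕ} (hc : Odd c) (h : a * d - b * c = 1)
    (k : ℤ) (H : EtaTransform a (b + a * k) c (d + c * k)) : EtaTransform a b c d := by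
  intro z hz
  have hz' : 0 < (z - k : ℂ).im := by simpa using hz
  have := H (z - k) hz'
  have e1 : ((a : ℂ) * (z - k) + (b + a * k : ℤ)) / (c * (z - k) + (d + c * k : ℤ)) =
      (a * z + b) / (c * z + d) := by push_cast; ring_nf
  have e2 : ((c : ℂ) * (z - k) + (d + c * k : ℤ)) = c * z + d := by push_cast; ring
  rw [e1, e2] at this
  rw [this, sub_eq_add_neg, show (-(k : ℂ)) = ((-k : ℤ) : ℂ) by push_cast; rfl, eta_add_int]
  have hJ : J(d + c * k | c) = J(d | c) := jacobiSym.mod_left' (by simp)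
  rw [hJ]
  have hE : zeta ^ etaExp a (b + a * k) c (d + c * k) * zeta ^ (-k) = zeta ^ etaExp a b c d := by
    rw [← zpow_add₀ zeta_ne_zero]
    obtain ⟨m, hm⟩ := dvd_cube_sub_of_odd (c := (c : ℤ)) (by exact_mod_cast hc)
    have : etaExp a (b + a * k) c (d + c * k) + -k = 24 * (-m * k * (2 * b + a * k))
        + etaExp a b c d := by
      unfold etaExp
      linear_combination (-k * (2 * b + a * k)) * hm - (c ^ 2 - 1) * k * h
    rw [this, zpow_add₀ zeta_ne_zero, zeta_zpow_eq_one (dvd_mul_right _ _), one_mul]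
  rw [← hE]; ring

/-- Quadratic reciprocity in multiplier form: the exponents differ by `3 + 3(c+1)(d-1)`, and `zeta ^
(3(c+1)(d-1)) = (-1)^((c+1)(d-1)/4)` is the reciprocity sign times the value of `(-1/d)`. -/
lemma jacobiSym_zeta {a b : ℤ} {c d : ℕ} (hc : Odd c) (hd : Odd d) (h : a * d - b * c = 1) :
    (J(d | c) : ℂ) * zeta ^ etaExp a b c d =
      zeta ^ 3 * (J(-c | d) * zeta ^ etaExp b (-a) d (-c)) := by
  have hE : etaExp a b c d = 3 + (3 * (c + 1) * (d - 1) + etaExp b (-a) d (-c)) := by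
    unfold etaExp; linear_combination (c * d : ℤ) * h
  rw [hE, zpow_add₀ zeta_ne_zero, zpow_add₀ zeta_ne_zero]
  suffices hs : (J(d | c) : ℂ) * zeta ^ (3 * (c + 1) * (d - 1) : ℤ) = J(-c | d) by
    rw [← hs, show zeta ^ (3 : ℤ) = zeta ^ 3 from mod_cast rfl]; ring
  have hc2 := Nat.odd_iff.1 hc
  have hd2 := Nat.odd_iff.1 hd
  rw [jacobiSym.neg _ hd, ← jacobiSym.quadratic_reciprocity_if hd2 hc2]
  obtain ⟨t, ht⟩ : ∃ t : ℤ, (c + 1 : ℤ) * (d - 1) = 4 * t := by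
    obtain ⟨x, rfl⟩ := hc; obtain ⟨y, rfl⟩ := hd
    exact ⟨(x + 1) * y, by push_cast; ring⟩
  rw [show (3 * (c + 1) * (d - 1) : ℤ) = 12 * t by linear_combination 3 * ht, zeta_zpow_twelve_mul]
  have hc4 : c % 4 = 1 ∨ c % 4 = 3 := by omega
  have hd4 : d % 4 = 1 ∨ d % 4 = 3 := by omega
  rcases hd4 with hd4 | hd4
  · have ht2 : Even t := by
      obtain ⟨x, hx⟩ : ∃ x, d = 4 * x + 1 := ⟨d / 4, by omega⟩
      obtain ⟨y, hy⟩ := hc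
      subst hx hy
      exact ⟨(y + 1) * x, by push_cast at ht; linarith⟩
    simp [ZMod.χ₄_nat_one_mod_four hd4, hd4, ht2.neg_one_zpow]
  · obtain ⟨x, hx⟩ : ∃ x, d = 4 * x + 3 := ⟨d / 4, by omega⟩
    rcases hc4 with hc4 | hc4
    · have ht2 : Odd t := by
        obtain ⟨y, hy⟩ : ∃ y, c = 4 * y + 1 := ⟨c / 4, by omega⟩
        subst hx hy
        exact ⟨2 * x * y + x + y, by push_cast at ht; linarith⟩
      simp [ZMod.χ₄_nat_three_mod_four hd4, hc4, ht2.neg_one_zpow]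
    · have ht2 : Even t := by
        obtain ⟨y, hy⟩ : ∃ y, c = 4 * y + 3 := ⟨c / 4, by omega⟩
        subst hx hy
        exact ⟨(y + 1) * (2 * x + 1), by push_cast at ht; linarith⟩
      simp [ZMod.χ₄_nat_three_mod_four hd4, hc4, hd4, ht2.neg_one_zpow]

/-- The law at `z` for the matrix with bottom row `(d, -c)` and the law at `-1/z` for `(c, d)` are
the same equation, since `(c(-1/z) + d) z = dz - c` and the square roots multiply without a sign. -/
lemma eta_inversion {a b : ℤ} {c d : ℕ} (hd0 : 0 < d) (hc0 : 0 < c) {z : ℂ} (hz : 0 < z.im)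
    (v : ℂ) :
    (eta ((b * z + (-a : ℤ)) / (d * z + (-c : ℤ))) =
      v * (sqrt I)⁻¹ * sqrt (d * z + (-c : ℤ)) * eta z) ↔
    eta ((a * (-1 / z) + b) / (c * (-1 / z) + d)) =
      zeta ^ 3 * v * (sqrt I)⁻¹ * sqrt (c * (-1 / z) + d) * eta (-1 / z) := by
  have h0 : z ≠ 0 := by rintro rfl; simp at hz
  have e0 : ((c : ℂ) * (-1 / z) + d) * z = d * z + (-c : ℤ) := by push_cast; field_simp; ring
  have hdR : (0 : ℝ) < d := mod_cast hd0
  have hcR : (0 : ℝ) < c := mod_cast hc0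
  have i1 : 0 < ((d : ℂ) * z + (-c : ℤ)).im := by
    simpa using mul_pos hdR hz
  have i2 : 0 < ((c : ℂ) * (-1 / z) + d).im := by
    have : 0 < ((-1 : ℂ) / z).im := by
      rw [neg_div, one_div, neg_im, inv_im]
      have := normSq_pos.2 h0
      rw [neg_div, neg_neg]; positivity
    simpa using mul_pos hcR this
  have n2 : ((c : ℂ) * (-1 / z) + d) ≠ 0 := by intro h; rw [h] at i2; simp at i2
  have e1 : ((a : ℂ) * (-1 / z) + b) / (c * (-1 / z) + d) =
      (b * z + (-a : ℤ)) / (d * z + (-c : ℤ)) := by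
    rw [← e0]; push_cast; field_simp; ring
  have e3 : sqrt ((c : ℂ) * (-1 / z) + d) * sqrt z = sqrt (d * z + (-c : ℤ)) := by
    rw [← e0]; exact sqrt_mul_of_im_pos i2 hz (by rwa [e0])
  have hI : sqrt I ≠ 0 := by rw [sqrt_I_eq_zeta]; exact pow_ne_zero _ zeta_ne_zero
  rw [e1, eta_neg_one_div hz, ← e3]
  have : zeta ^ 3 * v * (sqrt I)⁻¹ * sqrt (c * (-1 / z) + d) * ((sqrt I)⁻¹ * (sqrt z * eta z)) =
      v * (sqrt I)⁻¹ * (sqrt ((c : ℂ) * (-1 / z) + d) * sqrt z) * eta z := by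
    rw [← sqrt_I_eq_zeta]; field_simp
  rw [this]

lemma etaTransform_inversion_iff {a b : ℤ} {c d : ℕ} (hc : Odd c) (hd : Odd d)
    (h : a * d - b * c = 1) : EtaTransform a b c d ↔ EtaTransform b (-a) d (-c) := by
  have hv := jacobiSym_zeta hc hd h
  have key : ∀ z : ℂ, 0 < z.im → 0 < (-1 / z).im ∧ (-1 / (-1 / z)) = z := by
    intro z hz
    have h0 : z ≠ 0 := by rintro rfl; simp at hz
    refine ⟨?_, by field_simp⟩
    rw [neg_div, one_div, neg_im, inv_im]
    have := normSq_pos.2 h0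
    rw [neg_div, neg_neg]; positivity
  constructor
  · intro H z hz
    rw [eta_inversion (a := a) hd.pos hc.pos hz, ← hv]
    exact_mod_cast H _ (key z hz).1
  · intro H z hz
    have := H _ (key z hz).1
    rw [eta_inversion (a := a) hd.pos hc.pos (key z hz).1, (key z hz).2, ← hv] at this
    exact_mod_cast this

/-- The transformation law of the Dedekind eta function under the matrices in `SL₂(ℤ)` with odd
positive lower left entry. -/
theorem etaTransform (c : ℕ) (hc : Odd c) (a b d : ℤ) (h : a * d - b * c = 1) :
    EtaTransform a b c d := by
  induction c using Nat.strong_induction_on generalizing a b d with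
  | _ c ih =>
    -- Euclidean descent: translate to an odd representative of `d` modulo `c` of absolute value
    -- less than `c`, then invert so that it becomes the lower left entry. For `c = 1` the
    -- translation reaches `d = 0`, where the law is that of `-1/z + a`.
    by_cases hc1 : c = 1
    · subst hc1
      apply EtaTransform.translate hc h (-d)
      have hb : b + a * -d = -1 := by push_cast at h; linarith
      rw [hb]
      intro z hz
      have h0 : z ≠ 0 := by rintro rfl; simp at hz
      have e1 : ((a : ℂ) * z + (-1 : ℤ)) / ((1 : ℕ) * z + (d + (1 : ℕ) * -d : ℤ)) =
          -1 / z + a := by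
        rw [show (((1 : ℕ) : ℂ) * z + (d + (1 : ℕ) * -d : ℤ)) = z by push_cast; ring]
        push_cast; field_simp; ring
      have e2 : (((1 : ℕ) : ℂ) * z + (d + (1 : ℕ) * -d : ℤ)) = z := by push_cast; ring
      rw [e1, e2, eta_add_int, eta_neg_one_div hz, jacobiSym.one_right]
      simp [etaExp]; ring
    · have hc0 : (0 : ℤ) < c := mod_cast hc.pos
      have hr0 := Int.emod_nonneg d hc0.ne'
      have hr1 := Int.emod_lt_of_pos d hc0
      have hdm := Int.emod_add_mul_ediv d c
      have hcodd : (c : ℤ) % 2 = 1 := by exact_mod_cast Nat.odd_iff.1 hc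
      have hrne : d % c ≠ 0 := by
        intro h0
        obtain ⟨m, rfl⟩ := Int.dvd_of_emod_eq_zero h0
        have : (c : ℤ) ∣ 1 := ⟨a * m - b, by linear_combination -h⟩
        have := Int.le_of_dvd one_pos this
        omega
      by_cases hodd : (d % c) % 2 = 1
      · apply EtaTransform.translate hc h (-(d / c))
        have hd' : d + c * -(d / c) = d % c := by linear_combination -hdm
        rw [hd']
        obtain ⟨e, he⟩ := Int.eq_ofNat_of_zero_le hr0
        rw [he] at hr1 hodd hd' ⊢
        have heo : Odd e := Nat.odd_iff.2 (by omega)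
        have hdet : a * (e : ℤ) - (b + a * -(d / c)) * c = 1 := by
          linear_combination h - a * hd'
        rw [etaTransform_inversion_iff hc heo hdet]
        exact ih e (by omega) heo _ _ _ (by linear_combination hdet)
      -- As `c` is odd and the remainder even, `c - d % c` is odd. The representative is now
      -- negative, so the inversion equivalence is used in the opposite direction.
      · apply EtaTransform.translate hc h (-(d / c) - 1)
        have hd' : d + c * (-(d / c) - 1) = -(c - d % c) := by linear_combination -hdm
        rw [hd']
        obtain ⟨e, he⟩ := Int.eq_ofNat_of_zero_le (show 0 ≤ c - d % c by omega)
        rw [he] at hd' ⊢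
        have heo : Odd e := Nat.odd_iff.2 (by omega)
        have hdet : a * (-(e : ℤ)) - (b + a * (-(d / c) - 1)) * c = 1 := by
          linear_combination h - a * hd'
        have := (etaTransform_inversion_iff (a := -(b + a * (-(d / c) - 1))) (b := a) heo hc
          (by linear_combination hdet)).1 (ih e (by omega) heo _ _ _ (by linear_combination hdet))
        simpa using this

end EtaClassPoly

/-! ### The double eta quotient under Atkin–Lehner matrices. -/

namespace EtaClassPoly

open Complex hiding eta
open ModularForm NumberTheorySymbols

lemma im_div_natCast_pos {z : ℂ} (hz : 0 < z.im) {n : ℕ} (hn : 0 < n) : 0 < (z / n).im := by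
  rw [div_natCast_im]; positivity

lemma doubleEta_ne_zero {p₁ p₂ : ℕ} (h₁ : 0 < p₁) (h₂ : 0 < p₂) {z : ℂ} (hz : 0 < z.im) :
    doubleEta p₁ p₂ z ≠ 0 := by
  have h := im_div_natCast_pos hz (Nat.mul_pos h₁ h₂)
  push_cast at h
  exact div_ne_zero
    (mul_ne_zero (eta_ne_zero (im_div_natCast_pos hz h₁)) (eta_ne_zero (im_div_natCast_pos hz h₂)))
    (mul_ne_zero (eta_ne_zero hz) (eta_ne_zero h))

lemma sqrt_ne_zero_of_im_pos {z : ℂ} (hz : 0 < z.im) : sqrt z ≠ 0 := by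
  intro h
  simpa [h] using (sqrt_quadrant hz).1

lemma im_denom_pos {c : ℕ} (hc : 0 < c) (d : ℤ) {z : ℂ} (hz : 0 < z.im) :
    0 < (c * z + d : ℂ).im := by
  have : (0 : ℝ) < c := mod_cast hc
  simpa using mul_pos this hz

lemma sqrt_I_ne_zero : sqrt I ≠ 0 := by
  rw [sqrt_I_eq_zeta]; exact pow_ne_zero _ zeta_ne_zero

/-- The behaviour of `η(z / n)` under `z ↦ z / (z + 1)`. -/
lemma eta_lower_div {n : ℕ} (hn : Odd n) {z : ℂ} (hz : 0 < z.im) :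
    eta (z / (z + 1) / n) = zeta ^ (3 - n : ℤ) * (sqrt I)⁻¹ * sqrt (z + 1) * eta (z / n) := by
  have h := etaTransform n hn 1 0 1 (by simp) (z / n) (im_div_natCast_pos hz hn.pos)
  have hn0 : (n : ℂ) ≠ 0 := by exact_mod_cast hn.pos.ne'
  have e1 : (n : ℂ) * (z / n) = z := by field_simp
  have e2 : etaExp 1 0 n 1 = 3 - n := by unfold etaExp; ring
  simp only [Int.cast_one, Int.cast_zero, e1, e2, jacobiSym.one_left, one_mul, add_zero] at h
  rw [← h]; congr 1; ring_nf

/-- The four square root factors cancel, and the exponents combine to `(3-p₁) + (3-p₂) - (3-1) -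
(3-p₁p₂) = (p₁-1)(p₂-1)`. -/
lemma doubleEta_lower {p₁ p₂ : ℕ} (h₁ : Odd p₁) (h₂ : Odd p₂) {z : ℂ} (hz : 0 < z.im) :
    doubleEta p₁ p₂ (z / (z + 1)) = zeta ^ ((p₁ - 1) * (p₂ - 1) : ℤ) * doubleEta p₁ p₂ z := by
  have e0 := eta_lower_div odd_one hz
  have e1 := eta_lower_div h₁ hz
  have e2 := eta_lower_div h₂ hz
  have e3 := eta_lower_div (h₁.mul h₂) hz
  push_cast at e0 e1 e2 e3
  rw [div_one, div_one] at e0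
  have hs : sqrt (z + 1) ≠ 0 := sqrt_ne_zero_of_im_pos (by simpa using hz)
  have hzz : zeta ^ (3 - p₁ : ℤ) * zeta ^ (3 - p₂ : ℤ) =
      zeta ^ ((p₁ - 1) * (p₂ - 1) : ℤ) * (zeta ^ (3 - 1 : ℤ) * zeta ^ (3 - p₁ * p₂ : ℤ)) := by
    simp only [← zpow_add₀ zeta_ne_zero]; congr 1; ring
  have n0 := zpow_ne_zero (3 - 1 : ℤ) zeta_ne_zero
  have n1 := zpow_ne_zero (3 - p₁ * p₂ : ℤ) zeta_ne_zero
  have hI := sqrt_I_ne_zero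
  unfold doubleEta
  rw [e0, e1, e2, e3]
  calc _ = (zeta ^ (3 - p₁ : ℤ) * zeta ^ (3 - p₂ : ℤ)) * ((sqrt I)⁻¹ * sqrt (z + 1)) ^ 2 *
        (eta (z / p₁) * eta (z / p₂)) /
        (zeta ^ (3 - 1 : ℤ) * zeta ^ (3 - p₁ * p₂ : ℤ) * ((sqrt I)⁻¹ * sqrt (z + 1)) ^ 2 *
        (eta z * eta (z / (p₁ * p₂)))) := by ring_nf
    _ = _ := by
      rw [hzz]
      have : ((sqrt I)⁻¹ * sqrt (z + 1)) ^ 2 ≠ 0 := pow_ne_zero _ (mul_ne_zero (inv_ne_zero hI) hs)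
      rw [mul_div_assoc' _ _ (eta z * _), ← mul_div_mul_left (zeta ^ ((p₁ - 1) * (p₂ - 1) : ℤ) * _)
        _ (mul_ne_zero (mul_ne_zero n0 n1) this)]
      ring_nf

lemma jacobiSym_atkinLehner {p₁ p₂ c : ℕ} (hp : 0 < p₁) (hc : 0 < c) {a b d : ℤ}
    (h : p₂ * a * d - p₁ * b * c = 1) :
    J(d | p₁ * c) * J(p₂ * d | c) = J(p₂ | p₁) * (J(d | c) * J(p₂ * d | p₁ * c)) := by
  have : NeZero p₁ := ⟨hp.ne'⟩
  have : NeZero c := ⟨hc.ne'⟩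
  have g : Int.gcd p₂ p₁ = 1 := Int.isCoprime_iff_gcd_eq_one.1 ⟨a * d, -(b * c), by linear_combination h⟩
  rw [jacobiSym.mul_left, jacobiSym.mul_left, jacobiSym.mul_right, jacobiSym.mul_right]
  linear_combination (-(J(d | p₁) * J(d | c) ^ 2 * J(p₂ | c))) * jacobiSym.sq_one g

/-- The behaviour of the double eta quotient under the Atkin–Lehner involution at `p₂`. -/
lemma doubleEta_atkinLehner_of_odd {p₁ p₂ c : ℕ} (h₁ : Odd p₁) (h₂ : Odd p₂) (hc : Odd c)
    {a b d : ℤ} (h : p₂ * a * d - p₁ * b * c = 1) {z : ℂ} (hz : 0 < z.im) :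
    ∃ k : ℤ, doubleEta p₁ p₂ ((p₂ * a * z + p₁ * p₂ * b) / (c * z + p₂ * d)) * doubleEta p₁ p₂ z =
      J(p₂ | p₁) * zeta ^ ((p₁ - 1) * (p₂ - 1) * k : ℤ) := by
  have hz₁ := im_div_natCast_pos hz h₁.pos
  have hz₂ := im_div_natCast_pos hz h₂.pos
  have hz₃ := im_div_natCast_pos hz (h₁.mul h₂).pos
  have n₁ : (p₁ : ℂ) ≠ 0 := by exact_mod_cast h₁.pos.ne'
  have n₂ : (p₂ : ℂ) ≠ 0 := by exact_mod_cast h₂.pos.ne'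
  -- With `v` the image of `z`, four unimodular matrices carry `z/p₂, z, z/p₁, z/(p₁p₂)` to `v,
  -- v/p₂, v/(p₁p₂), v/p₁` respectively. The factors `sqrt u` and `sqrt (u / p₂)` each occur once
  -- above and once below in the quotient at `v`.
  have t0 := etaTransform c hc (p₂ * a) (p₁ * b) d h _ hz₂
  have t1 := etaTransform c hc a (p₁ * b) (p₂ * d) (by linear_combination h) _ hz
  have t2 := etaTransform (p₁ * c) (h₁.mul hc) a b (p₂ * d)
    (by push_cast; linear_combination h) _ hz₁
  have t3 := etaTransform (p₁ * c) (h₁.mul hc) (p₂ * a) b d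
    (by push_cast; linear_combination h) _ hz₃
  have hd0 : (c * z + p₂ * d : ℂ) ≠ 0 := by
    have := im_denom_pos hc.pos (p₂ * d) hz
    intro h0; push_cast at this; rw [h0] at this; simp at this
  set u : ℂ := c * z + p₂ * d with hu
  have d0 : ((c : ℂ) * (z / p₂) + d) = u / p₂ := by rw [hu]; field_simp
  have d1 : ((c : ℂ) * z + (p₂ * d : ℤ)) = u := by rw [hu]; push_cast; ring
  have d2 : (((p₁ * c : ℕ) : ℂ) * (z / p₁) + (p₂ * d : ℤ)) = u := by
    rw [hu]; push_cast; field_simp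
  have d3 : (((p₁ * c : ℕ) : ℂ) * (z / (p₁ * p₂ : ℕ)) + d) = u / p₂ := by
    rw [hu]; push_cast; field_simp
  have m0 : (((p₂ * a : ℤ) : ℂ) * (z / p₂) + (p₁ * b : ℤ)) / (u / p₂) =
      (p₂ * a * z + p₁ * p₂ * b) / u := by push_cast; field_simp
  have m1 : ((a : ℂ) * z + (p₁ * b : ℤ)) / u = (p₂ * a * z + p₁ * p₂ * b) / u / p₂ := by
    push_cast; field_simp
  have m2 : ((a : ℂ) * (z / p₁) + b) / u = (p₂ * a * z + p₁ * p₂ * b) / u / (p₁ * p₂) := by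
    field_simp
  have m3 : (((p₂ * a : ℤ) : ℂ) * (z / (p₁ * p₂ : ℕ)) + b) / (u / p₂) =
      (p₂ * a * z + p₁ * p₂ * b) / u / p₁ := by push_cast; field_simp
  rw [d0, m0] at t0
  rw [d1, m1] at t1
  rw [d2, m2] at t2
  rw [d3, m3] at t3
  set v : ℂ := (p₂ * a * z + p₁ * p₂ * b) / u
  have s1 : sqrt u ≠ 0 := by
    rw [← d1]; exact sqrt_ne_zero_of_im_pos (im_denom_pos hc.pos _ hz)
  have s2 : sqrt (u / p₂) ≠ 0 := by
    rw [← d0]; exact sqrt_ne_zero_of_im_pos (im_denom_pos hc.pos _ hz₂)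
  have hr := inv_ne_zero sqrt_I_ne_zero
  have hJ := jacobiSym_atkinLehner h₁.pos hc.pos h
  have g1 : Int.gcd d c = 1 :=
    Int.isCoprime_iff_gcd_eq_one.1 ⟨p₂ * a, -(p₁ * b), by linear_combination h⟩
  have g2 : Int.gcd (p₂ * d) (p₁ * c : ℕ) = 1 :=
    Int.isCoprime_iff_gcd_eq_one.1 ⟨a, -b, by push_cast; linear_combination h⟩
  have j1 : (J(d | c) : ℂ) ≠ 0 := mod_cast jacobiSym.ne_zero g1
  have j2 : (J(p₂ * d | p₁ * c) : ℂ) ≠ 0 := mod_cast jacobiSym.ne_zero g2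
  have hJ' : (J(d | p₁ * c) : ℂ) * J(p₂ * d | c) =
      J(p₂ | p₁) * (J(d | c) * J(p₂ * d | p₁ * c)) := mod_cast hJ
  -- The alternating sum of the four values of `etaExp`, divided by `(p₁-1)(p₂-1)`.
  refine ⟨c * (a - d) + b * d * (1 + p₁ * c ^ 2), ?_⟩
  have hE : zeta ^ etaExp (p₂ * a) b (p₁ * c : ℕ) d * zeta ^ etaExp a (p₁ * b) c (p₂ * d) =
      zeta ^ ((p₁ - 1) * (p₂ - 1) * (c * (a - d) + b * d * (1 + p₁ * c ^ 2)) : ℤ) *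
      (zeta ^ etaExp (p₂ * a) (p₁ * b) c d * zeta ^ etaExp a b (p₁ * c : ℕ) (p₂ * d)) := by
    simp only [← zpow_add₀ zeta_ne_zero]; congr 1; unfold etaExp; push_cast; ring
  have z0 := zpow_ne_zero (etaExp (p₂ * a) (p₁ * b) c d) zeta_ne_zero
  have z2 := zpow_ne_zero (etaExp a b (p₁ * c : ℕ) (p₂ * d)) zeta_ne_zero
  have y0 := eta_ne_zero hz
  have y1 := eta_ne_zero hz₁
  have y2 := eta_ne_zero hz₂
  have y3 := eta_ne_zero hz₃
  unfold doubleEta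
  rw [t0, t1, t2, t3]
  push_cast at y3 hE hJ' j1 j2 z0 z2 ⊢
  set r : ℂ := (sqrt I)⁻¹
  set ζ₀ := zeta ^ etaExp (p₂ * a) (p₁ * b) c d
  set ζ₂ := zeta ^ etaExp a b (p₁ * c) (p₂ * d)
  set ζ₁ := zeta ^ etaExp a (p₁ * b) c (p₂ * d)
  set ζ₃ := zeta ^ etaExp (p₂ * a) b (p₁ * c) d
  set ζ := zeta ^ ((p₁ - 1) * (p₂ - 1) * (c * (a - d) + b * d * (1 + p₁ * c ^ 2)) : ℤ)
  rw [div_mul_div_comm, div_eq_iff (by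
    repeat' first | assumption | apply mul_ne_zero)]
  linear_combination r ^ 2 * sqrt u * sqrt (u / p₂) * eta z * eta (z / p₁) * eta (z / p₂) *
    eta (z / (p₁ * p₂)) * (ζ₃ * ζ₁ * hJ' + J(p₂ | p₁) * (J(d | c) * J(p₂ * d | p₁ * c)) * hE)

lemma dvd_etaExponent_mul (p₁ p₂ : ℕ) (h₁ : 0 < p₁) (h₂ : 0 < p₂) (k : ℤ) :
    (24 : ℤ) ∣ (p₁ - 1) * (p₂ - 1) * k * etaExponent p₁ p₂ := by
  have h : 24 ∣ (p₁ - 1) * (p₂ - 1) * etaExponent p₁ p₂ := by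
    unfold etaExponent
    obtain ⟨m, hm⟩ := Nat.gcd_dvd_right 24 ((p₁ - 1) * (p₂ - 1))
    nth_rewrite 1 [hm]
    rw [mul_right_comm, Nat.mul_div_cancel' (Nat.gcd_dvd_left _ _)]
    exact dvd_mul_right _ _
  have h' : (24 : ℤ) ∣ ((p₁ - 1 : ℕ) : ℤ) * ((p₂ - 1 : ℕ) : ℤ) * etaExponent p₁ p₂ := by
    exact_mod_cast h
  rw [Nat.cast_sub h₁, Nat.cast_sub h₂] at h'
  simpa [mul_right_comm] using h'.mul_right k

lemma zeta_zpow_pow_etaExponent {p₁ p₂ : ℕ} (h₁ : 0 < p₁) (h₂ : 0 < p₂) (k : ℤ) :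
    (zeta ^ ((p₁ - 1) * (p₂ - 1) * k : ℤ)) ^ etaExponent p₁ p₂ = 1 := by
  rw [← zpow_natCast, ← zpow_mul]
  exact zeta_zpow_eq_one (dvd_etaExponent_mul p₁ p₂ h₁ h₂ k)

lemma doubleEta_lower_pow {p₁ p₂ : ℕ} (h₁ : Odd p₁) (h₂ : Odd p₂) {z : ℂ} (hz : 0 < z.im) :
    doubleEta p₁ p₂ (z / (z + 1)) ^ etaExponent p₁ p₂ =
      doubleEta p₁ p₂ z ^ etaExponent p₁ p₂ := by
  have := zeta_zpow_pow_etaExponent h₁.pos h₂.pos 1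
  rw [mul_one] at this
  rw [doubleEta_lower h₁ h₂ hz, mul_pow, this, one_mul]

/-- If the exponent `s` is even, both sides are 1. If it is odd, `24 ∣ (p₁-1)(p₂-1)s` prevents both
`p₁` and `p₂` from being 3 modulo 4, so the reciprocity sign is trivial. -/
lemma jacobiSym_pow_etaExponent {p₁ p₂ : ℕ} (h₁ : Odd p₁) (h₂ : Odd p₂) (h : Nat.Coprime p₁ p₂) :
    J(p₂ | p₁) ^ etaExponent p₁ p₂ = J(p₁ | p₂) ^ etaExponent p₁ p₂ := by
  rcases Nat.even_or_odd (etaExponent p₁ p₂) with he | ho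
  · obtain ⟨m, hm⟩ := he
    have a1 := jacobiSym.sq_one (a := p₂) (b := p₁) (by simpa using h.symm)
    have a2 := jacobiSym.sq_one (a := p₁) (b := p₂) (by simpa using h)
    rw [hm, ← two_mul, pow_mul, pow_mul, a1, a2]
  · have h8 : ¬(p₁ % 4 = 3 ∧ p₂ % 4 = 3) := by
      rintro ⟨q₁, q₂⟩
      obtain ⟨k, hk⟩ := dvd_etaExponent_mul p₁ p₂ h₁.pos h₂.pos 1
      obtain ⟨x, rfl⟩ : ∃ x, p₁ = 4 * x + 3 := ⟨p₁ / 4, by omega⟩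
      obtain ⟨y, rfl⟩ : ∃ y, p₂ = 4 * y + 3 := ⟨p₂ / 4, by omega⟩
      obtain ⟨t, ht⟩ := ho
      rw [ht] at hk
      push_cast at hk
      have hk' : (2 * x + 1 : ℤ) * (2 * y + 1) * (2 * t + 1) = 2 * (3 * k) := by linarith
      have := congrArg (· % 2) hk'
      simp [Int.mul_emod, Int.add_emod] at this
    have := jacobiSym.quadratic_reciprocity_if (Nat.odd_iff.1 h₁) (Nat.odd_iff.1 h₂)
    rw [if_neg h8] at this
    rw [this]

/-- The transformation of the `s`-th power of the double eta quotient under all Atkin–Lehner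
matrices at `p₂`. -/
theorem doubleEta_atkinLehner {p₁ p₂ : ℕ} (h₁ : Odd p₁) (h₂ : Odd p₂) {a b c d : ℤ}
    (h : p₂ * a * d - p₁ * b * c = 1) {z : ℂ} (hz : 0 < z.im) :
    doubleEta p₁ p₂ ((p₂ * a * z + p₁ * p₂ * b) / (c * z + p₂ * d)) ^ etaExponent p₁ p₂ *
      doubleEta p₁ p₂ z ^ etaExponent p₁ p₂ = (J(p₁ | p₂) : ℂ) ^ etaExponent p₁ p₂ := by
  have hcop : Nat.Coprime p₁ p₂ := Nat.isCoprime_iff_coprime.1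
    ⟨-(b * c), a * d, by linear_combination h⟩
  have hJ : (J(p₂ | p₁) : ℂ) ^ etaExponent p₁ p₂ = (J(p₁ | p₂) : ℂ) ^ etaExponent p₁ p₂ :=
    mod_cast jacobiSym_pow_etaExponent h₁ h₂ hcop
  have pos : ∀ (c : ℕ) (a b d : ℤ), Odd c → p₂ * a * d - p₁ * b * c = 1 → ∀ z : ℂ, 0 < z.im →
      doubleEta p₁ p₂ ((p₂ * a * z + p₁ * p₂ * b) / (c * z + p₂ * d)) ^ etaExponent p₁ p₂ *
        doubleEta p₁ p₂ z ^ etaExponent p₁ p₂ = (J(p₁ | p₂) : ℂ) ^ etaExponent p₁ p₂ := by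
    intro c a b d hc h z hz
    obtain ⟨k, hk⟩ := doubleEta_atkinLehner_of_odd h₁ h₂ hc h hz
    rw [← mul_pow, hk, mul_pow, zeta_zpow_pow_etaExponent h₁.pos h₂.pos, mul_one, hJ]
  have odd : ∀ a b c d : ℤ, Odd c → p₂ * a * d - p₁ * b * c = 1 → ∀ z : ℂ, 0 < z.im →
      doubleEta p₁ p₂ ((p₂ * a * z + p₁ * p₂ * b) / (c * z + p₂ * d)) ^ etaExponent p₁ p₂ *
        doubleEta p₁ p₂ z ^ etaExponent p₁ p₂ = (J(p₁ | p₂) : ℂ) ^ etaExponent p₁ p₂ := by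
    intro a b c d hc h z hz
    obtain ⟨n, rfl | rfl⟩ := Int.eq_nat_or_neg c
    · exact_mod_cast pos n a b d (by exact_mod_cast hc) h z hz
    -- Negating the whole matrix changes neither its action nor its determinant.
    · have := pos n (-a) (-b) (-d) (by simpa using hc) (by linear_combination h) z hz
      rw [← this]
      congr 3
      rw [← neg_div_neg_eq]; push_cast; ring_nf
  rcases Int.even_or_odd c with he | ho
  · have hd : Odd d := by
      by_contra hd
      rw [Int.not_odd_iff_even] at hd
      have : Even (1 : ℤ) := by rw [← h]; exact (hd.mul_left _).sub (he.mul_left _)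
      simp at this
    have hp₂ : Odd (p₂ * d) := Odd.mul (by exact_mod_cast h₂) hd
    have h1z : (1 - z : ℂ) ≠ 0 := by
      intro h0; have := congrArg im h0; simp at this; exact hz.ne' this
    have hz' : 0 < (z / (1 - z)).im := by
      simpa [neg_add_eq_sub] using moebius_im_pos (a := 1) (b := 0) (c := -1) (d := 1) (by norm_num) hz
    have hz'1 : z / (1 - z) + 1 = 1 / (1 - z) := by field_simp; ring
    have e1 : z / (1 - z) / (z / (1 - z) + 1) = z := by rw [hz'1]; field_simp
    -- For even `c`, `d` must be odd. Writing `z = z'/(z'+1)` with `z' = z/(1-z)` multiplies the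
    -- matrix on the right by `(1 0; 1 1)`, making the lower left entry the odd number `c + p₂ d`.
    have key := odd (a + p₁ * b) b (c + p₂ * d) d (he.add_odd hp₂) (by linear_combination h) _ hz'
    rw [← doubleEta_lower_pow h₁ h₂ hz', e1] at key
    rw [← key]
    congr 3
    push_cast
    rw [← mul_div_mul_right (p₂ * a * z + p₁ * p₂ * b : ℂ) _ (inv_ne_zero h1z)]
    congr 1
    · field_simp; ring
    · field_simp; ring
  · exact odd a b c d ho h z hz

end EtaClassPoly

/-! ### Ideals attached to forms and their invertibility. -/

namespace EtaClassPoly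

open Complex hiding eta

lemma sqrtDisc_sq {D : ℤ} (hD : D < 0) : sqrtDisc D ^ 2 = D := by
  have h : (0 : ℝ) ≤ -(D : ℝ) := by
    have : (D : ℝ) < 0 := mod_cast hD
    linarith
  rw [sqrtDisc, mul_pow, I_sq, ← ofReal_pow, Real.sq_sqrt h]; push_cast; ring

lemma sqrtDisc_im_pos {D : ℤ} (hD : D < 0) : 0 < (sqrtDisc D).im := by
  have : (0 : ℝ) < -(D : ℝ) := by
    have : (D : ℝ) < 0 := mod_cast hD
    linarith
  simpa [sqrtDisc] using this

namespace BinForm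

variable {D : ℤ} {q : BinForm}

/-- The second generator `(-b + √D) / 2` of the ideal attached to a form. -/
noncomputable def gen (D : ℤ) (q : BinForm) : ℂ := (-(q.b : ℂ) + sqrtDisc D) / 2

lemma gen_im_pos (hD : D < 0) : 0 < (q.gen D).im := by
  have := sqrtDisc_im_pos hD
  have h : (q.gen D).im = (sqrtDisc D).im / 2 := by
    rw [gen, show ((2 : ℂ)) = ((2 : ℕ) : ℂ) by norm_num, div_natCast_im]; simp
  rw [h]; positivity

lemma gen_sq (hD : D < 0) (hq : q.disc = D) :
    q.gen D ^ 2 = -(q.b * q.gen D) - q.a * q.c := by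
  have h := sqrtDisc_sq hD
  have hd : (D : ℂ) = q.b ^ 2 - 4 * q.a * q.c := by rw [← hq, disc]; push_cast; ring
  rw [hd] at h
  unfold gen
  linear_combination h / 4

lemma int_smul_add_gen_inj (hD : D < 0) {m n m' n' : ℤ}
    (h : (m : ℂ) + n * q.gen D = m' + n' * q.gen D) : m = m' ∧ n = n' := by
  have hi := congrArg im h
  have hp := gen_im_pos (q := q) hD
  simp at hi
  have hn : n = n' := by
    rcases hi with hi | hi
    · exact hi
    · exact absurd hi hp.ne'
  subst hn
  exact ⟨by exact_mod_cast add_right_cancel h, rfl⟩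

lemma root_eq (hq : q.a ≠ 0) : q.root D = q.gen D / q.a := by
  have : (q.a : ℂ) ≠ 0 := mod_cast hq
  unfold root gen; field_simp

lemma root_im_pos (hD : D < 0) (hq : 0 < q.a) : 0 < (q.root D).im := by
  obtain ⟨n, hn⟩ := Int.eq_ofNat_of_zero_le hq.le
  rw [root_eq hq.ne', hn]
  exact im_div_natCast_pos (gen_im_pos hD) (by omega)

/-- Since `b ≡ D` modulo 2, `q.gen D` differs from `(D + √D)/2` by an integer, so any form of
discriminant `D` yields a `ℤ`-basis `1, gen` of the order. -/
lemma mem_quadOrder_iff (hD : D < 0) (hq : q.disc = D) {x : ℂ} :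
    x ∈ quadOrder D ↔ ∃ m n : ℤ, x = m + n * q.gen D := by
  obtain ⟨k, hk⟩ : ∃ k : ℤ, q.b + D = 2 * k := by
    have : Even (q.b + D) := by
      rw [← hq, disc, sq, show q.b + (q.b * q.b - 4 * q.a * q.c) =
        q.b * (q.b + 1) - 2 * (2 * q.a * q.c) by ring]
      exact (Int.even_mul_succ_self _).sub (even_two_mul _)
    exact this.two_dvd
  have hk' : (q.b : ℂ) + D = 2 * k := mod_cast hk
  have hω : ((D : ℂ) + sqrtDisc D) / 2 = k + (1 : ℤ) * q.gen D := by
    unfold gen; push_cast; linear_combination hk' / 2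
  constructor
  · intro hx
    induction hx using Algebra.adjoin_induction with
    | mem x hx => exact ⟨k, 1, by rw [← hω]; exact hx⟩
    | algebraMap r => exact ⟨r, 0, by simp⟩
    | add x y _ _ hx hy =>
      obtain ⟨m, n, rfl⟩ := hx
      obtain ⟨m', n', rfl⟩ := hy
      exact ⟨m + m', n + n', by push_cast; ring⟩
    | mul x y _ _ hx hy =>
      obtain ⟨m, n, rfl⟩ := hx
      obtain ⟨m', n', rfl⟩ := hy
      exact ⟨m * m' - n * n' * q.a * q.c, m * n' + n * m' - n * n' * q.b, by
        push_cast; linear_combination (n * n' : ℂ) * gen_sq hD hq⟩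
  · rintro ⟨m, n, rfl⟩
    have hg : q.gen D = ((D : ℂ) + sqrtDisc D) / 2 - ((k : ℤ) : ℂ) := by rw [hω]; push_cast; ring
    have hmem : ((D : ℂ) + sqrtDisc D) / 2 ∈ quadOrder D :=
      Algebra.subset_adjoin (Set.mem_singleton _)
    rw [hg]
    exact add_mem (intCast_mem _ _) (mul_mem (intCast_mem _ _) (sub_mem hmem (intCast_mem _ _)))

lemma gen_mem (hD : D < 0) (hq : q.disc = D) : q.gen D ∈ quadOrder D :=
  (mem_quadOrder_iff hD hq).2 ⟨0, 1, by simp⟩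

lemma mem_ideal_iff (hD : D < 0) (hq : q.disc = D) {x : quadOrder D} :
    x ∈ q.ideal D ↔ ∃ m n : ℤ, (x : ℂ) = m * q.a + n * q.gen D := by
  constructor
  · intro hx
    induction hx using Submodule.span_induction with
    | mem x hx =>
      rcases hx with hx | hx
      · exact ⟨1, 0, by simpa using hx⟩
      · exact ⟨0, 1, by simpa [gen] using hx⟩
    | zero => exact ⟨0, 0, by simp⟩
    | add x y _ _ hx hy =>
      obtain ⟨m, n, hx⟩ := hx
      obtain ⟨m', n', hy⟩ := hy
      exact ⟨m + m', n + n', by push_cast; rw [hx, hy]; ring⟩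
    | smul r x _ hx =>
      obtain ⟨m, n, hx⟩ := hx
      obtain ⟨u, v, hr⟩ := (mem_quadOrder_iff hD hq).1 r.2
      refine ⟨u * m - v * n * q.c, u * n + v * m * q.a - v * n * q.b, ?_⟩
      rw [smul_eq_mul, MulMemClass.coe_mul, hx, hr]
      push_cast; linear_combination (v * n : ℂ) * gen_sq hD hq
  · rintro ⟨m, n, hx⟩
    have h1 : (⟨(q.a : ℂ), intCast_mem _ _⟩ : quadOrder D) ∈ q.ideal D :=
      Ideal.subset_span (Or.inl rfl)
    have h2 : (⟨q.gen D, gen_mem hD hq⟩ : quadOrder D) ∈ q.ideal D :=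
      Ideal.subset_span (Or.inr rfl)
    have : x = (m : quadOrder D) * ⟨(q.a : ℂ), intCast_mem _ _⟩ +
        (n : quadOrder D) * ⟨q.gen D, gen_mem hD hq⟩ := by
      apply Subtype.ext; push_cast; exact hx
    rw [this]
    exact add_mem (Ideal.mul_mem_left _ _ h1) (Ideal.mul_mem_left _ _ h2)

/-- The opposite form `[a, -b, c]`. -/
def conj (q : BinForm) : BinForm := ⟨q.a, -q.b, q.c⟩

/-- With `g, g'` the second generators, `g' = g + b` and `g g' = -ac`. The product contains `a²`,
`ab` and `ac`, hence `a` by primitivity; conversely every product of elements is divisible by `a`.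
-/
lemma ideal_mul_conj (hD : D < 0) (hq : q.disc = D) (hp : q.IsPrimitive) :
    q.ideal D * q.conj.ideal D = Ideal.span {(q.a : quadOrder D)} := by
  have hq' : q.conj.disc = D := by rw [← hq]; simp [conj, disc]
  have hg : q.conj.gen D = q.gen D + q.b := by unfold gen conj; push_cast; ring
  have ha' : q.conj.a = q.a := rfl
  apply le_antisymm
  · rw [Ideal.mul_le]
    intro x hx y hy
    obtain ⟨m, n, hx⟩ := (mem_ideal_iff hD hq).1 hx
    obtain ⟨m', n', hy⟩ := (mem_ideal_iff hD hq').1 hy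
    rw [Ideal.mem_span_singleton]
    refine ⟨⟨(m * m' * q.a + m * n' * q.b - n * n' * q.c : ℤ) + (m * n' + n * m' : ℤ) * q.gen D,
      (mem_quadOrder_iff hD hq).2 ⟨_, _, rfl⟩⟩, ?_⟩
    apply Subtype.ext
    rw [MulMemClass.coe_mul, MulMemClass.coe_mul, hx, hy, hg, ha']
    push_cast
    linear_combination (n * n' : ℂ) * gen_sq hD hq
  · rw [Ideal.span_singleton_le_iff_mem]
    obtain ⟨u, v, huv⟩ : ∃ u v, (1 : ℤ) = q.a * u + (Int.gcd q.b q.c : ℤ) * v :=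
      ⟨_, _, by rw [← Int.gcd_eq_gcd_ab, hp, Nat.cast_one]⟩
    have hbc := Int.gcd_eq_gcd_ab q.b q.c
    set s := Int.gcdA q.b q.c
    set t := Int.gcdB q.b q.c
    rw [hbc] at huv
    have huv' : (1 : ℂ) = q.a * u + (q.b * s + q.c * t) * v := mod_cast huv
    set A : quadOrder D := ⟨(q.a : ℂ), intCast_mem _ _⟩
    set G : quadOrder D := ⟨q.gen D, gen_mem hD hq⟩
    set G' : quadOrder D := ⟨q.conj.gen D, gen_mem hD hq'⟩
    have a1 : A ∈ q.ideal D := (mem_ideal_iff hD hq).2 ⟨1, 0, by simp [A]⟩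
    have a2 : A ∈ q.conj.ideal D := (mem_ideal_iff hD hq').2 ⟨1, 0, by simp [A, ha']⟩
    have a3 : G ∈ q.ideal D := (mem_ideal_iff hD hq).2 ⟨0, 1, by simp [G]⟩
    have a4 : G' ∈ q.conj.ideal D := (mem_ideal_iff hD hq').2 ⟨0, 1, by simp [G']⟩
    have : (q.a : quadOrder D) = (u : quadOrder D) * (A * A) +
        ((s * v : ℤ) : quadOrder D) * (A * G' - G * A) - ((t * v : ℤ) : quadOrder D) * (G * G') := by
      apply Subtype.ext
      push_cast
      simp only [A, G, G', hg]
      linear_combination (q.a : ℂ) * huv' + (t * v : ℂ) * gen_sq hD hq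
    rw [this]
    exact sub_mem (add_mem (Ideal.mul_mem_left _ _ (Ideal.mul_mem_mul a1 a2))
      (Ideal.mul_mem_left _ _ (sub_mem (Ideal.mul_mem_mul a1 a4) (Ideal.mul_mem_mul a3 a2))))
      (Ideal.mul_mem_left _ _ (Ideal.mul_mem_mul a3 a4))

lemma intCast_quadOrder_ne_zero {n : ℤ} (hn : n ≠ 0) : (n : quadOrder D) ≠ 0 := by
  intro h
  have := congrArg Subtype.val h
  push_cast at this
  exact hn (by exact_mod_cast this)

/-- The ideal attached to a primitive form is invertible. -/
lemma exists_hasClass (hD : D < 0) (hq : q.disc = D) (hp : q.IsPrimitive) (ha : q.a ≠ 0) :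
    ∃ κ : ClassGroup (quadOrder D), HasClass (q.ideal D) κ := by
  have hu : IsUnit ((q.ideal D : FractionalIdeal (quadOrder D)⁰ (FractionRing (quadOrder D)))) := by
    apply isUnit_of_mul_isUnit_left (y := (q.conj.ideal D :
      FractionalIdeal (quadOrder D)⁰ (FractionRing (quadOrder D))))
    rw [← FractionalIdeal.coeIdeal_mul, ideal_mul_conj hD hq hp,
      FractionalIdeal.coeIdeal_span_singleton]
    refine IsUnit.of_mul_eq_one _ (FractionalIdeal.spanSingleton_mul_inv _ ?_)
    rw [Ne, FaithfulSMul.algebraMap_eq_zero_iff]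
    exact intCast_quadOrder_ne_zero ha
  obtain ⟨J, hJ⟩ := hu
  exact ⟨_, J, hJ, rfl⟩

end BinForm

/-! ### Ideal classes and `SL₂(ℤ)`-equivalence of roots. -/

lemma HasClass.exists_span_mul_eq {R : Type*} [CommRing R] [IsDomain R] {I I' : Ideal R}
    {κ : ClassGroup R} (h : HasClass I κ) (h' : HasClass I' κ) :
    ∃ x y : R, x ≠ 0 ∧ y ≠ 0 ∧ Ideal.span {x} * I = Ideal.span {y} * I' := by
  obtain ⟨J, hJ, hκ⟩ := h
  obtain ⟨J', hJ', hκ'⟩ := h'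
  exact (ClassGroup.mk_eq_mk_of_coe_ideal hJ hJ').1 (hκ.trans hκ'.symm)

lemma HasClass.eq_of_span_mul_eq {R : Type*} [CommRing R] [IsDomain R] {I I' : Ideal R}
    {κ κ' : ClassGroup R} (h : HasClass I κ) (h' : HasClass I' κ') {x y : R} (hx : x ≠ 0)
    (hy : y ≠ 0) (hxy : Ideal.span {x} * I = Ideal.span {y} * I') : κ = κ' := by
  obtain ⟨J, hJ, hκ⟩ := h
  obtain ⟨J', hJ', hκ'⟩ := h'
  rw [← hκ, ← hκ']
  exact (ClassGroup.mk_eq_mk_of_coe_ideal hJ hJ').2 ⟨x, y, hx, hy, hxy⟩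

namespace BinForm

variable {D : ℤ} {q q' : BinForm}

/-- Forms whose ideals lie in the same class have `SL₂(ℤ)`-equivalent roots. -/
lemma exists_moebius_of_hasClass (hD : D < 0) (hq : q.disc = D) (hq' : q'.disc = D)
    (ha : 0 < q.a) (ha' : 0 < q'.a) {κ : ClassGroup (quadOrder D)}
    (h : HasClass (q.ideal D) κ) (h' : HasClass (q'.ideal D) κ) :
    ∃ m₁ m₂ m₃ m₄ : ℤ, m₁ * m₄ - m₂ * m₃ = 1 ∧
      q.root D = (m₁ * q'.root D + m₂) / (m₃ * q'.root D + m₄) := by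
  obtain ⟨x, y, hx, hy, hxy⟩ := h.exists_span_mul_eq h'
  have hx0 : (x : ℂ) ≠ 0 := by simpa using hx
  have hy0 : (y : ℂ) ≠ 0 := by simpa using hy
  have aC : (q.a : ℂ) ≠ 0 := mod_cast ha.ne'
  have aC' : (q'.a : ℂ) ≠ 0 := mod_cast ha'.ne'
  have step : ∀ {q q' : BinForm}, q.disc = D → q'.disc = D → ∀ {x y : quadOrder D},
      Ideal.span {x} * q.ideal D = Ideal.span {y} * q'.ideal D → ∀ m n : ℤ, ∃ k l : ℤ,
        (x : ℂ) * (m * q.a + n * q.gen D) = y * (k * q'.a + l * q'.gen D) := by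
    intro q q' hq hq' x y hxy m n
    have hz : (m * q.a + n * q.gen D : ℂ) ∈ quadOrder D :=
      (mem_quadOrder_iff hD hq).2 ⟨m * q.a, n, by push_cast; rfl⟩
    obtain ⟨z, hz', hzz⟩ := Ideal.span_singleton_mul_le_span_singleton_mul.1 hxy.le ⟨_, hz⟩
      ((mem_ideal_iff hD hq).2 ⟨m, n, rfl⟩)
    obtain ⟨k, l, hkl⟩ := (mem_ideal_iff hD hq').1 hz'
    refine ⟨k, l, ?_⟩
    rw [← hkl]
    exact congrArg Subtype.val hzz
  obtain ⟨m, n, e1⟩ := step hq hq' hxy 1 0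
  obtain ⟨m₂, n₂, e2⟩ := step hq hq' hxy 0 1
  obtain ⟨k, l, e3⟩ := step hq' hq hxy.symm 1 0
  obtain ⟨k₂, l₂, e4⟩ := step hq' hq hxy.symm 0 1
  simp only [Int.cast_one, Int.cast_zero, one_mul, zero_mul, add_zero, zero_add] at e1 e2 e3 e4
  have f1 : (x : ℂ) * q.a = x * ((m * k + n * k₂) * q.a + (m * l + n * l₂) * q.gen D) := by
    linear_combination e1 + m * e3 + n * e4
  have f2 : (x : ℂ) * q.gen D = x * ((m₂ * k + n₂ * k₂) * q.a + (m₂ * l + n₂ * l₂) * q.gen D) := by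
    linear_combination e2 + m₂ * e3 + n₂ * e4
  have g1 := int_smul_add_gen_inj (q := q) hD (m := q.a) (n := 0) (m' := (m * k + n * k₂) * q.a)
    (n' := m * l + n * l₂) (by push_cast; simpa using mul_left_cancel₀ hx0 f1)
  have g2 := int_smul_add_gen_inj (q := q) hD (m := 0) (n := 1) (m' := (m₂ * k + n₂ * k₂) * q.a)
    (n' := m₂ * l + n₂ * l₂) (by push_cast; simpa using mul_left_cancel₀ hx0 f2)
  have c1 : m * k + n * k₂ = 1 := by
    have := g1.1
    exact mul_right_cancel₀ ha.ne' (by linarith)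
  have c2 : m₂ * k + n₂ * k₂ = 0 := by
    have := g2.1
    exact (mul_eq_zero.1 this.symm).resolve_right ha.ne'
  -- The matrices expressing each lattice basis through the other are mutually inverse over `ℤ`, so
  -- both determinants are `±1`.
  have hdet : (n₂ * m - m₂ * n) * (l₂ * k - k₂ * l) = 1 := by
    linear_combination (m₂ * l + n₂ * l₂) * c1 - (m * l + n * l₂) * c2 - g2.2
  have hne : (n * q'.root D + m : ℂ) ≠ 0 := by
    intro h0
    have : (x : ℂ) * q.a = 0 := by
      rw [e1, show (m * q'.a + n * q'.gen D : ℂ) = q'.a * (n * q'.root D + m) by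
        rw [root_eq ha'.ne']; field_simp; ring, h0]
      simp
    exact mul_ne_zero hx0 aC this
  have hr : q.root D = (n₂ * q'.root D + m₂) / (n * q'.root D + m) := by
    rw [eq_div_iff hne, root_eq ha.ne', root_eq ha'.ne']
    field_simp
    have : (x * y : ℂ) * (q.gen D * (n * q'.gen D + q'.a * m)) =
        (x * y) * (q.a * (n₂ * q'.gen D + q'.a * m₂)) := by
      linear_combination x * q.a * e2 - x * q.gen D * e1
    linear_combination mul_left_cancel₀ (mul_ne_zero hx0 hy0) this
  rcases Int.eq_one_or_neg_one_of_mul_eq_one hdet with hd | hd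
  · exact ⟨n₂, m₂, n, m, hd, hr⟩
  -- Determinant `-1` would put `q.root D` in the lower half-plane.
  · exfalso
    have := moebius_im_pos (a := -n₂) (b := -m₂) (c := n) (d := m) (by linear_combination -hd)
      (root_im_pos hD ha')
    have h2 := root_im_pos hD ha
    rw [hr] at h2
    rw [show ((-n₂ : ℤ) * q'.root D + (-m₂ : ℤ) : ℂ) = -(n₂ * q'.root D + m₂) by push_cast; ring,
      neg_div, neg_im] at this
    linarith

/-- Primitive forms with `SL₂(ℤ)`-equivalent roots have ideals in the same class. -/
lemma class_eq_of_moebius (hD : D < 0) (hq : q.disc = D) (hq' : q'.disc = D)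
    (ha : 0 < q.a) (ha' : 0 < q'.a) {m₁ m₂ m₃ m₄ : ℤ} (hdet : m₁ * m₄ - m₂ * m₃ = 1)
    (hr : q.root D = (m₁ * q'.root D + m₂) / (m₃ * q'.root D + m₄))
    {κ κ' : ClassGroup (quadOrder D)} (h : HasClass (q.ideal D) κ)
    (h' : HasClass (q'.ideal D) κ') : κ = κ' := by
  have aC : (q.a : ℂ) ≠ 0 := mod_cast ha.ne'
  have aC' : (q'.a : ℂ) ≠ 0 := mod_cast ha'.ne'
  have hne := denom_ne_zero hdet (root_im_pos hD ha')
  rw [eq_div_iff hne, root_eq ha.ne', root_eq ha'.ne'] at hr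
  have hxne : (m₄ * q'.a + m₃ * q'.gen D : ℂ) ≠ 0 := by
    rw [root_eq ha'.ne'] at hne
    intro h0
    apply hne
    field_simp
    linear_combination h0
  field_simp at hr
  have hr' : q.gen D * (m₄ * q'.a + m₃ * q'.gen D) = q.a * (m₂ * q'.a + m₁ * q'.gen D) := by
    linear_combination hr
  have hdet' : (m₁ * m₄ - m₂ * m₃ : ℂ) = 1 := mod_cast hdet
  have hxm : (m₄ * q'.a + m₃ * q'.gen D : ℂ) ∈ quadOrder D :=
    (mem_quadOrder_iff hD hq').2 ⟨m₄ * q'.a, m₃, by push_cast; rfl⟩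
  -- By `hr'`, multiplication by `m₄a' + m₃g'` sends the basis `a, g` of the first ideal to `a`
  -- times a unimodular transform of the basis `a', g'` of the second.
  refine h.eq_of_span_mul_eq h' (x := ⟨_, hxm⟩) (y := (q.a : quadOrder D)) ?_
    (intCast_quadOrder_ne_zero ha.ne') (le_antisymm ?_ ?_)
  · intro h0; exact hxne (congrArg Subtype.val h0)
  · rw [Ideal.span_singleton_mul_le_span_singleton_mul]
    intro z hz
    obtain ⟨k, l, hz⟩ := (mem_ideal_iff hD hq).1 hz
    refine ⟨⟨((k * m₄ + l * m₂) * q'.a : ℤ) + (k * m₃ + l * m₁ : ℤ) * q'.gen D,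
      (mem_quadOrder_iff hD hq').2 ⟨_, _, rfl⟩⟩, (mem_ideal_iff hD hq').2
        ⟨k * m₄ + l * m₂, k * m₃ + l * m₁, by push_cast; rfl⟩, Subtype.ext ?_⟩
    push_cast
    rw [hz]
    linear_combination (l : ℂ) * hr'
  · rw [Ideal.span_singleton_mul_le_span_singleton_mul]
    intro z hz
    obtain ⟨k, l, hz⟩ := (mem_ideal_iff hD hq').1 hz
    refine ⟨⟨((k * m₁ - l * m₂) * q.a : ℤ) + (l * m₄ - k * m₃ : ℤ) * q.gen D,
      (mem_quadOrder_iff hD hq).2 ⟨_, _, rfl⟩⟩, (mem_ideal_iff hD hq).2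
        ⟨k * m₁ - l * m₂, l * m₄ - k * m₃, by push_cast; rfl⟩, Subtype.ext ?_⟩
    push_cast
    rw [hz]
    linear_combination (-(q.a * (k * q'.a + l * q'.gen D)) : ℂ) * hdet' - (l * m₄ - k * m₃ : ℂ) * hr'

end BinForm

end EtaClassPoly

/-! ### Atkin–Lehner matrices acting on forms. -/

namespace EtaClassPoly

open NumberTheorySymbols

namespace BinForm

variable {D : ℤ} {q q' : BinForm}

/-- If the root of `q'` is the image of the root of `q` under a matrix in `SL₂(ℤ)`, then `q` is the
composite of `q'` with this matrix. -/
lemma eq_comp_of_moebius (hD : D < 0) (hq : q.disc = D) (hq' : q'.disc = D) (ha : 0 < q.a)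
    (ha' : 0 < q'.a) {m₁ m₂ m₃ m₄ : ℤ} (hdet : m₁ * m₄ - m₂ * m₃ = 1)
    (hr : q'.root D = (m₁ * q.root D + m₂) / (m₃ * q.root D + m₄)) :
    q.a = q'.a * m₁ ^ 2 + q'.b * m₁ * m₃ + q'.c * m₃ ^ 2 ∧
    q.b = 2 * q'.a * m₁ * m₂ + q'.b * (m₁ * m₄ + m₂ * m₃) + 2 * q'.c * m₃ * m₄ ∧
    q.c = q'.a * m₂ ^ 2 + q'.b * m₂ * m₄ + q'.c * m₄ ^ 2 := by
  have aC : (q.a : ℂ) ≠ 0 := mod_cast ha.ne'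
  have aC' : (q'.a : ℂ) ≠ 0 := mod_cast ha'.ne'
  have hne := denom_ne_zero hdet (root_im_pos hD ha)
  rw [eq_div_iff hne] at hr
  have hroot : q'.a * q'.root D ^ 2 + q'.b * q'.root D + q'.c = 0 := by
    rw [root_eq ha'.ne']
    field_simp
    linear_combination gen_sq hD hq'
  obtain ⟨A, hA⟩ : ∃ A, A = q'.a * m₁ ^ 2 + q'.b * m₁ * m₃ + q'.c * m₃ ^ 2 := ⟨_, rfl⟩
  obtain ⟨B, hB⟩ : ∃ B, B = 2 * q'.a * m₁ * m₂ + q'.b * (m₁ * m₄ + m₂ * m₃) +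
    2 * q'.c * m₃ * m₄ := ⟨_, rfl⟩
  obtain ⟨C, hC⟩ : ∃ C, C = q'.a * m₂ ^ 2 + q'.b * m₂ * m₄ + q'.c * m₄ ^ 2 := ⟨_, rfl⟩
  rw [← hA, ← hB, ← hC]
  have hz : A * q.root D ^ 2 + B * q.root D + C = 0 := by
    rw [hA, hB, hC]
    push_cast
    linear_combination (m₃ * q.root D + m₄) ^ 2 * hroot -
      (q'.a * (q'.root D * (m₃ * q.root D + m₄) + (m₁ * q.root D + m₂)) +
        q'.b * (m₃ * q.root D + m₄)) * hr
  rw [root_eq ha.ne'] at hz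
  field_simp at hz
  -- The transformed form `[A, B, C]` vanishes at the root of `q`. Comparing coordinates in the
  -- basis `1, gen` makes it proportional to `q`.
  have hz' : ((q.a * (C * q.a - A * q.c) : ℤ) : ℂ) + (B * q.a - A * q.b : ℤ) * q.gen D =
      (0 : ℤ) + (0 : ℤ) * q.gen D := by
    push_cast
    linear_combination hz - A * gen_sq hD hq
  obtain ⟨e1, e2⟩ := int_smul_add_gen_inj hD hz'
  have e1' : C * q.a - A * q.c = 0 := (mul_eq_zero.1 e1).resolve_left ha.ne'
  have hdisc : B ^ 2 - 4 * A * C = D := by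
    rw [← hq', disc, hA, hB, hC]
    linear_combination (q'.b ^ 2 - 4 * q'.a * q'.c) * (m₁ * m₄ - m₂ * m₃ + 1) * hdet
  -- Proportional forms of equal discriminant agree up to sign; positivity of `A` then fixes the
  -- sign.
  have hAsq : (A ^ 2 - q.a ^ 2) * D = 0 := by
    unfold disc at hq
    linear_combination (-A ^ 2) * hq + q.a ^ 2 * hdisc - (B * q.a + A * q.b) * e2 +
      4 * A * q.a * e1'
  have hApos : 0 < A := by
    have h4 : 4 * q'.a * A = (2 * q'.a * m₁ + q'.b * m₃) ^ 2 - D * m₃ ^ 2 := by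
      rw [hA, ← hq', disc]; ring
    have : 0 < (2 * q'.a * m₁ + q'.b * m₃) ^ 2 - D * m₃ ^ 2 := by
      by_cases h3 : m₃ = 0
      · subst h3
        have h1 : m₁ ≠ 0 := by rintro rfl; simp at hdet
        simp only [mul_zero, add_zero, ne_eq, OfNat.ofNat_ne_zero, not_false_eq_true, zero_pow,
          sub_zero]
        positivity
      · have : 0 < m₃ ^ 2 := by positivity
        nlinarith [sq_nonneg (2 * q'.a * m₁ + q'.b * m₃)]
    rw [← h4] at this
    exact pos_of_mul_pos_right this (by positivity)
  have hAa : A = q.a := by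
    have := sub_eq_zero.1 ((mul_eq_zero.1 hAsq).resolve_right hD.ne)
    exact (pow_left_inj₀ hApos.le ha.le two_ne_zero).1 this
  rw [hAa] at e1' e2
  refine ⟨hAa.symm, ?_, ?_⟩
  · exact mul_right_cancel₀ ha.ne' (by linear_combination -e2)
  · exact mul_right_cancel₀ ha.ne' (by linear_combination -e1')

/-- The form `[a p, b, c / p]`. -/
def scale (p : ℕ) (q : BinForm) : BinForm := ⟨q.a * p, q.b, q.c / p⟩

lemma disc_scale {p : ℕ} (hpc : (p : ℤ) ∣ q.c) : (q.scale p).disc = q.disc := by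
  simp only [disc, scale]
  linear_combination (-4 * q.a) * Int.mul_ediv_cancel' hpc

lemma root_scale (p : ℕ) : (q.scale p).root D = q.root D / p := by
  simp only [root, scale]
  push_cast
  rw [div_div]; ring_nf

/-- A prime dividing `ap`, `b` and `c/p` divides `c`. It either divides `a`, against primitivity of
`q`, or equals `p`, against `p ∤ b`. -/
lemma isPrimitive_scale {p : ℕ} (hp : p.Prime) (hpc : (p : ℤ) ∣ q.c) (hpb : ¬(p : ℤ) ∣ q.b)
    (hq : q.IsPrimitive) : (q.scale p).IsPrimitive := by
  by_contra h
  obtain ⟨r, hr, hdvd⟩ := Nat.exists_prime_and_dvd h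
  have hdvd' : (r : ℤ) ∣ ((q.scale p).a.gcd ((q.scale p).b.gcd (q.scale p).c) : ℕ) :=
    mod_cast hdvd
  obtain ⟨h1, h2⟩ := Int.dvd_coe_gcd_iff.1 hdvd'
  obtain ⟨hb, h3⟩ := Int.dvd_coe_gcd_iff.1 h2
  simp only [scale] at h1 hb h3
  have h4 : (r : ℤ) ∣ q.c := by
    rw [← Int.mul_ediv_cancel' hpc]; exact h3.mul_left _
  rcases (Nat.prime_iff_prime_int.1 hr).dvd_or_dvd h1 with h5 | h5
  · have : (r : ℤ) ∣ (q.a.gcd (q.b.gcd q.c) : ℕ) :=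
      Int.dvd_coe_gcd h5 (Int.dvd_coe_gcd hb h4)
    rw [hq] at this
    exact hr.one_lt.ne' (by exact_mod_cast Int.eq_one_of_dvd_one (by positivity) this)
  · have : r = p := (Nat.prime_dvd_prime_iff_eq hr hp).1 (by exact_mod_cast h5)
    subst this
    exact hpb hb

end BinForm

open BinForm

/-- If `p` divides `a x² + b x y` but not `x`, and `c` vanishes modulo `p`, then the middle
coefficient of the transformed form is `b` modulo `p`. -/
lemma dvd_middle_coeff_sub {p : ℤ} (hp : Prime p) {a b c x y z w : ℤ} (hdet : x * w - z * y = 1)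
    (hc : p ∣ c) (hx : ¬p ∣ x) (h : p ∣ a * x ^ 2 + b * x * y + c * y ^ 2) :
    p ∣ 2 * a * x * z + b * (x * w + z * y) + 2 * c * y * w - b := by
  have h1 : p ∣ x * (a * x + b * y) := by
    have := dvd_sub h (hc.mul_right (y ^ 2))
    ring_nf at this ⊢; exact this
  have h2 := (hp.dvd_or_dvd h1).resolve_left hx
  have : 2 * a * x * z + b * (x * w + z * y) + 2 * c * y * w - b =
      2 * z * (a * x + b * y) + c * (2 * y * w) := by linear_combination b * hdet
  rw [this]
  exact dvd_add (h2.mul_left _) (hc.mul_right _)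

/-- `z'` is the image of `z` under an Atkin–Lehner matrix of level `p₁ p₂` at `p₂`. -/
def AtkinLehnerRelated (p₁ p₂ : ℕ) (z z' : ℂ) : Prop :=
  ∃ a b c d : ℤ, p₂ * a * d - p₁ * b * c = 1 ∧
    z' = (p₂ * a * z + p₁ * p₂ * b) / (c * z + p₂ * d)

/-- It suffices that `p₂ ∣ m₁` and `p₁ ∣ m₂`. If `p₂ ∤ m₁`, comparing middle coefficients gives `q.b
≡ q'.b ≡ -q.b` modulo `p₂`; if `p₁ ∤ m₂`, it gives `q.b ≡ -q'.b ≡ -q.b` modulo `p₁`. Both are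
impossible for an odd prime not dividing `q.b`. -/
lemma atkinLehnerRelated_of_moebius {D : ℤ} {p₁ p₂ : ℕ} (hD : D < 0) (hp₁ : p₁.Prime)
    (hp₂ : p₂.Prime) (h2₁ : Odd p₁) (h2₂ : Odd p₂) {q q' : BinForm}
    (hq : q.disc = D) (hq' : q'.disc = D)
    (ha : 0 < q.a) (ha' : 0 < q'.a) (hc : ((p₁ * p₂ : ℕ) : ℤ) ∣ q.c)
    (hc' : ((p₁ * p₂ : ℕ) : ℤ) ∣ q'.c) (hb₁ : ¬(p₁ : ℤ) ∣ q.b) (hb₂ : ¬(p₂ : ℤ) ∣ q.b)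
    (h₁ : q'.b ≡ q.b [ZMOD p₁]) (h₂ : q'.b ≡ -q.b [ZMOD p₂])
    {m₁ m₂ m₃ m₄ : ℤ} (hdet : m₁ * m₄ - m₂ * m₃ = 1)
    (hr : q'.root D = (m₁ * (q.scale p₂).root D + m₂) / (m₃ * (q.scale p₂).root D + m₄)) :
    AtkinLehnerRelated p₁ p₂ (q.root D) (q'.root D) := by
  have i₁ := Nat.prime_iff_prime_int.1 hp₁
  have i₂ := Nat.prime_iff_prime_int.1 hp₂
  push_cast at hc hc'
  have hc₂ : (p₂ : ℤ) ∣ q.c := (dvd_mul_left _ _).trans hc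
  have hp₂pos : (0 : ℤ) < p₂ := mod_cast hp₂.pos
  obtain ⟨e1, e2, e3⟩ := eq_comp_of_moebius hD ((disc_scale hc₂).trans hq) hq'
    (mul_pos ha hp₂pos) ha' hdet hr
  simp only [scale] at e1 e2 e3
  have two : ∀ {p : ℕ}, p.Prime → Odd p → ∀ x : ℤ, (p : ℤ) ∣ 2 * x → (p : ℤ) ∣ x := by
    intro p hp ho x hx
    refine ((Nat.prime_iff_prime_int.1 hp).dvd_or_dvd hx).resolve_left fun h => ?_
    have := (Nat.prime_dvd_prime_iff_eq hp Nat.prime_two).1 (by exact_mod_cast h)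
    subst this; exact absurd ho (by decide)
  have d₁ : (p₂ : ℤ) ∣ m₁ := by
    by_contra hm
    have := dvd_middle_coeff_sub i₂ (w := m₄) (z := m₂) hdet ((dvd_mul_left _ _).trans hc') hm
      (e1 ▸ dvd_mul_left _ _)
    rw [← e2] at this
    have h := dvd_sub this h₂.dvd
    exact hb₂ (two hp₂ h2₂ _ (by ring_nf at h ⊢; exact h))
  have d₂ : (p₁ : ℤ) ∣ m₂ := by
    by_contra hm
    have hdiv : (p₁ : ℤ) ∣ q.c / p₂ := by
      obtain ⟨k, hk⟩ := hc
      rw [hk, show (p₁ * p₂ * k : ℤ) = p₂ * (p₁ * k) by ring, Int.mul_ediv_cancel_left _ hp₂pos.ne']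
      exact dvd_mul_right _ _
    -- Here the divisible coefficient is the last one, `q.c / p₂`. The columns of the matrix are
    -- exchanged to make it the leading one, and the signs are chosen to keep determinant 1.
    have := dvd_middle_coeff_sub i₁ (a := q'.a) (b := -q'.b) (c := q'.c) (x := m₂) (y := -m₄)
      (z := m₁) (w := -m₃) (by linear_combination hdet) ((dvd_mul_right _ _).trans hc') hm (by
        have h := e3 ▸ hdiv
        ring_nf at h ⊢; exact h)
    have this' : (p₁ : ℤ) ∣ q.b + q'.b := by
      rw [e2]; ring_nf at this ⊢; exact this
    have h := dvd_add this' h₁.dvd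
    exact hb₁ (two hp₁ h2₁ _ (by ring_nf at h ⊢; exact h))
  obtain ⟨a, rfl⟩ := d₁
  obtain ⟨b, rfl⟩ := d₂
  refine ⟨a, b, m₃, m₄, by linear_combination hdet, ?_⟩
  have hpC : (p₂ : ℂ) ≠ 0 := mod_cast hp₂.ne_zero
  rw [hr, root_scale, ← mul_div_mul_right _ _ hpC]
  push_cast
  congr 1 <;> field_simp

/-- Points with a common Atkin–Lehner image are `SL₂(ℤ)`-equivalent. -/
lemma AtkinLehnerRelated.moebius {p₁ p₂ : ℕ} (hp₂ : 0 < p₂) {z₁ z₂ w : ℂ}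
    (hz₁ : 0 < z₁.im) (hz₂ : 0 < z₂.im) (h₁ : AtkinLehnerRelated p₁ p₂ z₁ w)
    (h₂ : AtkinLehnerRelated p₁ p₂ z₂ w) :
    ∃ m₁ m₂ m₃ m₄ : ℤ, m₁ * m₄ - m₂ * m₃ = 1 ∧ z₂ = (m₁ * z₁ + m₂) / (m₃ * z₁ + m₄) := by
  obtain ⟨a, b, c, d, hdet, hw⟩ := h₁
  obtain ⟨a', b', c', d', hdet', hw'⟩ := h₂
  have hpC : (p₂ : ℂ) ≠ 0 := mod_cast hp₂.ne'
  have ne : ∀ {a b c d : ℤ} {z : ℂ}, p₂ * a * d - p₁ * b * c = 1 → 0 < z.im →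
      (c * z + p₂ * d : ℂ) ≠ 0 := by
    intro a b c d z h hz
    have := denom_ne_zero (a := a) (b := p₁ * b) (c := c) (d := p₂ * d) (by linear_combination h) hz
    push_cast at this
    exact this
  rw [hw, div_eq_div_iff (ne hdet hz₁) (ne hdet' hz₂)] at hw'
  have hdet₀ : (p₂ * a * d' - p₁ * b' * c) * (p₂ * a' * d - p₁ * b * c') -
      (p₁ * p₂ * (b * d' - b' * d)) * (a' * c - a * c') = (1 : ℤ) := by
    linear_combination (p₂ * a' * d' - p₁ * b' * c') * hdet + hdet'
  -- The entries of the inverse of the second Atkin–Lehner matrix times the first; the factor `p₂`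
  -- cancels, leaving an integral matrix of determinant 1.
  refine ⟨p₂ * a * d' - p₁ * b' * c, p₁ * p₂ * (b * d' - b' * d), a' * c - a * c',
    p₂ * a' * d - p₁ * b * c', hdet₀, ?_⟩
  rw [eq_div_iff (denom_ne_zero hdet₀ hz₁)]
  apply mul_left_cancel₀ hpC
  push_cast
  linear_combination -hw'

/-! ### Comparison of the two class polynomials. -/

lemma classPoly_eq_of_reciprocal {D : ℤ} {p₁ p₂ : ℕ} {S S' : Finset BinForm} {h : ℕ}
    (hS : S.card = h) (hS' : S'.card = h) (ε : ℂ) (f : BinForm → BinForm)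
    (hf : ∀ q ∈ S, f q ∈ S') (hinj : ∀ q ∈ S, ∀ r ∈ S, f q = f r → q = r)
    (hne : ∀ q ∈ S, doubleEta p₁ p₂ (q.root D) ≠ 0)
    (hw : ∀ q ∈ S, doubleEta p₁ p₂ ((f q).root D) ^ etaExponent p₁ p₂ *
      doubleEta p₁ p₂ (q.root D) ^ etaExponent p₁ p₂ = ε) :
    (classPoly D p₁ p₂ S).eval 0 ≠ 0 ∧
      algebraMap (Polynomial ℂ) (RatFunc ℂ) (classPoly D p₁ p₂ S') =
        RatFunc.X ^ h / RatFunc.C ((classPoly D p₁ p₂ S).eval 0) *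
          Polynomial.aeval (RatFunc.C ε / RatFunc.X) (classPoly D p₁ p₂ S) := by
  classical
  have himg : S.image f = S' := by
    apply Finset.eq_of_subset_of_card_le
    · exact Finset.image_subset_iff.2 hf
    · rw [Finset.card_image_of_injOn (fun q hq r hr => hinj q hq r hr), hS, hS']
  have heval : (classPoly D p₁ p₂ S).eval 0 =
      ∏ q ∈ S, -(doubleEta p₁ p₂ (q.root D) ^ etaExponent p₁ p₂) := by
    simp [classPoly, Polynomial.eval_prod]
  refine ⟨?_, ?_⟩
  · rw [heval]
    exact Finset.prod_ne_zero_iff.2 fun q hq => neg_ne_zero.2 (pow_ne_zero _ (hne q hq))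
  · rw [heval, ← himg, classPoly, classPoly,
      Finset.prod_image (fun q hq r hr => hinj q hq r hr), map_prod, map_prod, map_prod, ← hS,
      ← Finset.prod_const, ← Finset.prod_div_distrib, ← Finset.prod_mul_distrib]
    -- With `w` the value at `q`, the factor identity is `X - ε/w = (X / (-w)) (ε/X - w)`.
    refine Finset.prod_congr rfl fun q hq => ?_
    have hn : RatFunc.C (doubleEta p₁ p₂ (q.root D) ^ etaExponent p₁ p₂) ≠ 0 := by
      rw [Ne, map_eq_zero]
      exact pow_ne_zero _ (hne q hq)
    have hX : (RatFunc.X : RatFunc ℂ) ≠ 0 := RatFunc.X_ne_zero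
    have hwq := congrArg (RatFunc.C (K := ℂ)) (hw q hq)
    rw [map_mul] at hwq
    simp only [map_sub, Polynomial.aeval_X, Polynomial.aeval_C, RatFunc.algebraMap_X,
      RatFunc.algebraMap_C, map_neg]
    rw [← hwq, show algebraMap ℂ (RatFunc ℂ) = RatFunc.C from rfl]
    field_simp
    ring

lemma not_dvd_of_legendreSym_eq_one {D : ℤ} {p : ℕ} [Fact p.Prime] (h : legendreSym p D = 1)
    {q : BinForm} (hq : q.disc = D) (hc : (p : ℤ) ∣ q.c) : ¬(p : ℤ) ∣ q.b := by
  intro hb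
  have : (p : ℤ) ∣ D := by
    rw [← hq, disc]
    exact dvd_sub (dvd_pow hb two_ne_zero) (hc.mul_left _)
  have h0 := (legendreSym.eq_zero_iff p D).2 ((ZMod.intCast_zmod_eq_zero_iff_dvd D p).2 this)
  omega

end EtaClassPoly

open EtaClassPoly in
theorem proposition3p8 (D : ℤ) (hD : D < 0) (hD4 : D % 4 = 0 ∨ D % 4 = 1)
    (p₁ p₂ : ℕ) [Fact p₁.Prime] [Fact p₂.Prime] (hp₁ : Odd p₁) (hp₂ : Odd p₂) (hp : p₁ ≠ p₂)
    (h₁ : legendreSym p₁ D = 1) (h₂ : legendreSym p₂ D = 1)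
    (B B' : ℤ) (hB : B ^ 2 ≡ D [ZMOD 4 * (p₁ * p₂ : ℕ)])
    (hB' : B' ^ 2 ≡ D [ZMOD 4 * (p₁ * p₂ : ℕ)])
    (hBB₁ : B' ≡ B [ZMOD p₁]) (hBB₂ : B' ≡ -B [ZMOD p₂])
    (S S' : Finset EtaClassPoly.BinForm)
    (hS : EtaClassPoly.IsNSystem D (p₁ * p₂) S) (hBS : ⟨1, B, (B ^ 2 - D) / 4⟩ ∈ S)
    (hS' : EtaClassPoly.IsNSystem D (p₁ * p₂) S') (hBS' : ⟨1, B', (B' ^ 2 - D) / 4⟩ ∈ S') :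
    (EtaClassPoly.classPoly D p₁ p₂ S).eval 0 ≠ 0 ∧
      algebraMap (Polynomial ℂ) (RatFunc ℂ) (EtaClassPoly.classPoly D p₁ p₂ S') =
        RatFunc.X ^ EtaClassPoly.classNumber D /
            RatFunc.C ((EtaClassPoly.classPoly D p₁ p₂ S).eval 0) *
          Polynomial.aeval
            (RatFunc.C (((legendreSym p₂ p₁ : ℤ) : ℂ) ^ EtaClassPoly.etaExponent p₁ p₂) / RatFunc.X)
            (EtaClassPoly.classPoly D p₁ p₂ S) := by
  have P₁ : p₁.Prime := Fact.out
  have P₂ : p₂.Prime := Fact.out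
  have related : ∀ q ∈ S, ∃ q' ∈ S', AtkinLehnerRelated p₁ p₂ (q.root D) (q'.root D) := by
    intro q hq
    have hc := hS.dvd q hq
    have hc₁ : (p₁ : ℤ) ∣ q.c := (by push_cast; exact dvd_mul_right _ _ : (p₁ : ℤ) ∣ _).trans hc
    have hc₂ : (p₂ : ℤ) ∣ q.c := (by push_cast; exact dvd_mul_left _ _ : (p₂ : ℤ) ∣ _).trans hc
    have hb₁ := not_dvd_of_legendreSym_eq_one h₁ (hS.disc_eq q hq) hc₁
    have hb₂ := not_dvd_of_legendreSym_eq_one h₂ (hS.disc_eq q hq) hc₂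
    have ha : 0 < (q.scale p₂).a := mul_pos (hS.pos q hq) (mod_cast P₂.pos)
    have hdisc := (BinForm.disc_scale hc₂).trans (hS.disc_eq q hq)
    -- The partner of `q` is the member of `S'` in the class of the form with root `q.root D / p₂`.
    obtain ⟨κ, hκ⟩ := BinForm.exists_hasClass hD hdisc
      (BinForm.isPrimitive_scale P₂ hc₂ hb₂ (hS.primitive q hq)) ha.ne'
    obtain ⟨q', ⟨hq', hκ'⟩, -⟩ := hS'.representatives κ
    obtain ⟨m₁, m₂, m₃, m₄, hdet, hr⟩ := BinForm.exists_moebius_of_hasClass hD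
      (hS'.disc_eq q' hq') hdisc (hS'.pos q' hq') ha hκ' hκ
    have c := hS.congr q hq _ hBS
    have c' := hS'.congr q' hq' _ hBS'
    have k₁ : (p₁ : ℤ) ∣ 2 * (p₁ * p₂ : ℕ) := ⟨2 * p₂, by push_cast; ring⟩
    have k₂ : (p₂ : ℤ) ∣ 2 * (p₁ * p₂ : ℕ) := ⟨2 * p₁, by push_cast; ring⟩
    exact ⟨q', hq', atkinLehnerRelated_of_moebius hD P₁ P₂ hp₁ hp₂ (hS.disc_eq q hq)
      (hS'.disc_eq q' hq') (hS.pos q hq) (hS'.pos q' hq') hc (hS'.dvd q' hq') hb₁ hb₂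
      -- Within each system all middle coefficients agree modulo `p₁` and `p₂` with `B`,
      -- respectively `B'`, so the hypotheses on `B` and `B'` pass to `q` and `q'`.
      (((c'.of_dvd k₁).trans hBB₁).trans (c.of_dvd k₁).symm)
      (((c'.of_dvd k₂).trans hBB₂).trans (c.of_dvd k₂).symm.neg) hdet hr⟩
  choose! f hf hrel using related
  refine classPoly_eq_of_reciprocal hS.card_eq hS'.card_eq _ f hf ?_ ?_ ?_
  · intro q hq r hr hqr
    have hq' := hrel q hq
    rw [hqr] at hq'
    obtain ⟨m₁, m₂, m₃, m₄, hdet, hm⟩ := hq'.moebius P₂.pos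
      (BinForm.root_im_pos hD (hS.pos q hq)) (BinForm.root_im_pos hD (hS.pos r hr)) (hrel r hr)
    obtain ⟨κ, hκ⟩ := hS.invertible q hq
    obtain ⟨κ', hκ'⟩ := hS.invertible r hr
    have := BinForm.class_eq_of_moebius hD (hS.disc_eq r hr) (hS.disc_eq q hq) (hS.pos r hr)
      (hS.pos q hq) hdet hm hκ' hκ
    subst this
    exact (hS.representatives _).unique ⟨hq, hκ⟩ ⟨hr, hκ'⟩
  · exact fun q hq => doubleEta_ne_zero P₁.pos P₂.pos (BinForm.root_im_pos hD (hS.pos q hq))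
  · intro q hq
    obtain ⟨a, b, c, d, hdet, hr⟩ := hrel q hq
    rw [hr, doubleEta_atkinLehner hp₁ hp₂ hdet (BinForm.root_im_pos hD (hS.pos q hq)),
      jacobiSym.legendreSym.to_jacobiSym]
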